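/- Let $F$ be a number field of degree $n$ with ring of integers $\mathbb Z_F$, with $r_2$ complex places, let $n_\sigma=1$ (resp. $2$) for a real (resp. complex) place $\sigma$, and let $\mathfrak m=\mathfrak m_f\mathfrak m_\infty$ be a modulus: a nonzero integral ideal $\mathfrak m_f$ and a set $\mathfrak m_\infty$ of real places. Let $U(\mathfrak m)$ be the group of idèles $x$ such that $x_{\mathfrak p}\in\mathbb Z_{\mathfrak p}^\times$ and $x_{\mathfrak p}\equiv 1 \bmod \mathfrak p^{v_{\mathfrak p}(\mathfrak m_f)}$ for all primes $\mathfrak p$, $x_\sigma=1$ for $\sigma\in\mathfrak m_\infty$ and for $\sigma$ complex, and $x_\sigma=\pm1$ for the other real $\sigma$. Let $C_{\mathfrak m}=\mathbb A_F^\times/(F^\times U(\mathfrak m))$, let $C^1_{\mathfrak m}$ be the kernel of the idèle norm $\|x\|=\prod_v|x_v|_v$ on $C_{\mathfrak m}$, and let $\widehat C^1_{\mathfrak m}=\operatorname{Hom}_{\rm cont}(C^1_{\mathfrak m},\mathbb U)$ be its Pontryagin dual, where $\mathbb U$ is the circle group. Choose a finite set $S$ of primes generating the class group of $F$, a uniformizer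 $\pi_{\mathfrak p}$ at every prime, and an isomorphism $\log_{\mathfrak m}\colon(\mathbb Z_F/\mathfrak m)^\times=(\mathbb Z_F/\mathfrak m_f)^\times\times\prod_{\sigma\in\mathfrak m_\infty}\{\pm1\}\to\mathbb Z^r/\Lambda_{\mathfrak m}$, and put $\ell=\#S+r$. Let $U_S$ be the group of idèles that are units at all primes outside $S$, and let $\mathcal L_S\colon U_S\to(\mathbb Z^\ell\times\mathbb R^n)/(\Lambda_{\mathfrak m}+\mathbb Z^{r_2})$ be the homomorphism $$\mathcal L_S(x)=\Bigl((v_{\mathfrak p}(x_{\mathfrak p}))_{\mathfrak p\in S},\ \log_{\mathfrak m}\bigl(u\bmod\mathfrak m_f,(\operatorname{sgn}x_\sigma)_{\sigma\in\mathfrak m_\infty}\bigr),\ \bigl(\tfrac{n_\sigma}{2\pi}\log|x_\sigma|\bigr)_{\sigma},\ \bigl(\tfrac{\arg x_\sigma}{2\pi}\bigr)_{\sigma\text{ complex}}\Bigr),$$ where $u_{\mathfrak p}=x_{\mathfrak p}\pi_{\mathfrak p}^{-v_{\mathfrak p}(x_{\mathfrak p})}$, where $|\cdot|$ is the usual absolute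 value on $\mathbb R$ or $\mathbb C$, and where $\mathbb Z^{r_2}$ is embedded in the last $r_2$ coordinates. Let $\Lambda=\mathcal L_S(F^\times\cap U_S)+\Lambda_{\mathfrak m}+\mathbb Z^{r_2}\subset\mathbb Z^\ell\times\mathbb R^n$, and let $\mathcal L\colon C_{\mathfrak m}\to(\mathbb Z^\ell\times\mathbb R^n)/\Lambda$ be defined by $\mathcal L(x)=\mathcal L_S(x\alpha^{-1})$ for any $\alpha\in F^\times$ with $x\alpha^{-1}\in U_S$. Let $v_0\in\mathbb R^{\ell+n}$ be the vector with entry $n_\sigma$ at the coordinate $\frac{n_\sigma}{2\pi}\log|x_\sigma|$ for each archimedean place $\sigma$, and $0$ elsewhere, and let $p_0\colon\mathbb R^{\ell+n}\to H=(\mathbb Rv_0)^\perp$ be the orthogonal projection for the standard inner product. Then: 1. $p_0(\Lambda)$ is a full-rank lattice in $H$, and $\mathbb Z^\ell\subset H$ is contained in the dual lattice $p_0(\Lambda)^\vee=\{w\in H: w\cdot y\in\mathbb Z\text{ for all }y\in p_0(\Lambda)\}$. 2. $p_0\circ\mathcal L$ induces an isomorphism of topological groups $\widehat C^1_{\mathfrak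 m}\cong p_0(\Lambda)^\vee/\mathbb Z^\ell$, under which the class of $w\in p_0(\Lambda)^\vee$ corresponds to the character $x\mapsto\exp\bigl(2\pi i\,w\cdot p_0(\mathcal L(x))\bigr)$ of $C^1_{\mathfrak m}$. 3. In particular $\widehat C^1_{\mathfrak m}$ is a discrete, finitely generated abelian group. -/

import Mathlib

open NumberField IsDedekindDomain HeightOneSpectrum Module

open scoped WithZero RealInnerProductSpace

noncomputable section

namespace Hecke

variable (F : Type*) [Field F] [NumberField F]

/-- The group of idèles of `F`, with the topology of the units of the adèle ring. -/
abbrev Ideles := (AdeleRing (𝓞 F) F)ˣ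

/-- The diagonal embedding of `Fˣ` into the idèles. -/
def diag : Fˣ →* Ideles F := Units.map (algebraMap F (AdeleRing (𝓞 F) F)).toMonoidHom

variable {F}

/-- The component `x_𝔭` of an idèle. -/
def finComp (p : HeightOneSpectrum (𝓞 F)) : Ideles F →* p.adicCompletion F where
  toFun x := (x : AdeleRing (𝓞 F) F).2 p
  map_one' := rfl
  map_mul' _ _ := rfl

/-- The component `x_σ` of an idèle, in the completion of `F` at `σ`. -/
def infComp (σ : InfinitePlace F) : Ideles F →* σ.Completion where
  toFun x := (x : AdeleRing (𝓞 F) F).1 σ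
  map_one' := rfl
  map_mul' _ _ := rfl

theorem finComp_ne_zero (p : HeightOneSpectrum (𝓞 F)) (x : Ideles F) : finComp p x ≠ 0 :=
  ((Group.isUnit x).map (finComp p)).ne_zero

theorem infComp_ne_zero (σ : InfinitePlace F) (x : Ideles F) : infComp σ x ≠ 0 :=
  ((Group.isUnit x).map (infComp σ)).ne_zero

theorem finComp_eventually (x : Ideles F) :
    ∀ᶠ p in Filter.cofinite, Valued.v (finComp p x) = 1 :=
  (FiniteAdeleRing.isUnit_iff (a := (x : AdeleRing (𝓞 F) F).2).1
    ⟨⟨(x : AdeleRing (𝓞 F) F).2, ((x⁻¹ : Ideles F) : AdeleRing (𝓞 F) F).2,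
      congrArg Prod.snd x.mul_inv, congrArg Prod.snd x.inv_mul⟩, rfl⟩).2

/-! ### The norm -/

theorem norm_eq_one_iff (p : HeightOneSpectrum (𝓞 F)) (x : p.adicCompletion F) :
    ‖x‖ = 1 ↔ Valued.v x = 1 := by
  rw [FinitePlace.norm_def]
  constructor
  · intro h
    by_contra hne
    rcases lt_or_gt_of_ne hne with h1 | h1
    · have := WithZeroMulInt.toNNReal_strictMono (one_lt_absNorm_nnreal p) h1
      simp only [map_one] at this
      rw [← NNReal.coe_lt_coe] at this
      exact this.ne (by simpa using h)
    · have := WithZeroMulInt.toNNReal_strictMono (one_lt_absNorm_nnreal p) h1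
      simp only [map_one] at this
      rw [← NNReal.coe_lt_coe] at this
      exact this.ne' (by simpa using h)
  · intro h
    simp [h]

theorem norm_mulSupport (x : Ideles F) :
    (Function.mulSupport fun p ↦ ‖finComp p x‖).Finite := by
  have := finComp_eventually x
  rw [Filter.eventually_cofinite] at this
  refine this.subset fun p hp hv ↦ hp ((norm_eq_one_iff p _).2 hv)

/-- The norm `‖x‖ = ∏_v |x_v|_v` of an idèle, for the normalized absolute values: the square of
the usual one at a complex place, and `|π_𝔭|_𝔭 = N(𝔭)⁻¹` at a prime `𝔭`. -/
def ideleNorm : Ideles F →* ℝ where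
  toFun x := (∏ σ : InfinitePlace F, ‖infComp σ x‖ ^ σ.mult) *
    ∏ᶠ p : HeightOneSpectrum (𝓞 F), ‖finComp p x‖
  map_one' := by simp
  map_mul' x y := by
    simp only [map_mul, norm_mul, mul_pow, Finset.prod_mul_distrib]
    rw [finprod_mul_distrib (norm_mulSupport x) (norm_mulSupport y)]
    ring

theorem ideleNorm_diag (α : Fˣ) : ideleNorm (diag F α) = 1 := by
  rw [← prod_abs_eq_one (K := F) α.ne_zero]
  change (∏ σ : InfinitePlace F, ‖infComp σ (diag F α)‖ ^ σ.mult) *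
    (∏ᶠ p : HeightOneSpectrum (𝓞 F), ‖finComp p (diag F α)‖) = _
  congr 1
  · refine Finset.prod_congr rfl fun σ _ ↦ ?_
    congr 1
    exact InfinitePlace.Completion.norm_coe σ _
  · rw [← finprod_comp_equiv FinitePlace.equivHeightOneSpectrum.symm]
    rfl

/-! ### Moduli -/

variable (F) in
/-- A modulus `𝔪 = 𝔪_f 𝔪_∞`: a nonzero integral ideal and a set of real places. -/
structure Modulus where
  fin : Ideal (𝓞 F)
  fin_ne_bot : fin ≠ ⊥
  inf : Finset (InfinitePlace F)
  inf_isReal : ∀ σ ∈ inf, σ.IsReal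

/-- The exponent `v_𝔭(𝔪_f)`. -/
def Modulus.exponent (𝔪 : Modulus F) (p : HeightOneSpectrum (𝓞 F)) : ℕ :=
  multiplicity p.asIdeal 𝔪.fin

/-- The group `U(𝔪)` of idèles congruent to `1` modulo `𝔪`. At the primes `𝔭 ∤ 𝔪_f` the
exponent is `0` and the condition is that `x_𝔭` is a unit. -/
def Modulus.congrOne (𝔪 : Modulus F) : Subgroup (Ideles F) where
  carrier := {x |
    (∀ p, Valued.v (finComp p x) = 1 ∧
      Valued.v (finComp p x - 1) ≤ WithZero.exp (-(𝔪.exponent p : ℤ))) ∧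
    (∀ σ ∈ 𝔪.inf, infComp σ x = 1) ∧
    (∀ σ : InfinitePlace F, σ.IsReal → σ ∉ 𝔪.inf → infComp σ x = 1 ∨ infComp σ x = -1) ∧
    (∀ σ : InfinitePlace F, σ.IsComplex → infComp σ x = 1)}
  one_mem' := by simp
  mul_mem' := by
    rintro x y ⟨hx1, hx2, hx3, hx4⟩ ⟨hy1, hy2, hy3, hy4⟩
    refine ⟨fun p ↦ ⟨by simp [hx1, hy1], ?_⟩, fun σ hσ ↦ by simp [hx2 σ hσ, hy2 σ hσ],
      fun σ h h' ↦ ?_, fun σ hσ ↦ by simp [hx4 σ hσ, hy4 σ hσ]⟩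
    · have : finComp p (x * y) - 1 = finComp p x * (finComp p y - 1) + (finComp p x - 1) := by
        rw [map_mul]; ring
      rw [this]
      refine Valuation.map_add_le _ ?_ (hx1 p).2
      rw [map_mul, (hx1 p).1, one_mul]
      exact (hy1 p).2
    · rw [map_mul]
      rcases hx3 σ h h' with a | a <;> rcases hy3 σ h h' with b | b <;> simp [a, b]
  inv_mem' := by
    rintro x ⟨hx1, hx2, hx3, hx4⟩
    have key1 : ∀ p, finComp p x⁻¹ = (finComp p x)⁻¹ := fun p ↦
      eq_inv_of_mul_eq_one_left (by rw [← map_mul]; simp)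
    have key2 : ∀ σ, infComp σ x⁻¹ = (infComp σ x)⁻¹ := fun σ ↦
      eq_inv_of_mul_eq_one_left (by rw [← map_mul]; simp)
    refine ⟨fun p ↦ ⟨by simp [key1, hx1], ?_⟩, fun σ hσ ↦ by simp [key2, hx2 σ hσ],
      fun σ h h' ↦ ?_, fun σ hσ ↦ by simp [key2, hx4 σ hσ]⟩
    · have : finComp p x⁻¹ - 1 = -((finComp p x)⁻¹ * (finComp p x - 1)) := by
        have := finComp_ne_zero p x
        rw [key1]; field_simp; ring
      rw [this, Valuation.map_neg, map_mul, map_inv₀, (hx1 p).1, inv_one, one_mul]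
      exact (hx1 p).2
    · rw [key2]
      rcases hx3 σ h h' with a | a <;> simp [a]

/-- The subgroup `Fˣ · U(𝔪)` of the idèles. -/
abbrev Modulus.kernel (𝔪 : Modulus F) : Subgroup (Ideles F) := (diag F).range ⊔ 𝔪.congrOne

/-- The idèle class group `C_𝔪 = 𝔸_Fˣ / (Fˣ · U(𝔪))`, with the quotient topology. -/
abbrev Modulus.IdeleClassGroup (𝔪 : Modulus F) : Type _ := Ideles F ⧸ 𝔪.kernel

/-- The norm `C_𝔪 → ℝ_{>0}`. -/
def Modulus.norm (𝔪 : Modulus F) : 𝔪.IdeleClassGroup →* ℝ :=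
  QuotientGroup.lift 𝔪.kernel ideleNorm (by
    have : 𝔪.kernel ≤ (ideleNorm (F := F)).ker := by
      refine sup_le ?_ ?_
      · rintro _ ⟨α, rfl⟩
        exact ideleNorm_diag α
      · rintro x ⟨hx1, hx2, hx3, hx4⟩
        change _ * _ = (1 : ℝ)
        rw [Finset.prod_eq_one, finprod_eq_one_of_forall_eq_one, mul_one]
        · exact fun p ↦ (norm_eq_one_iff p _).2 (hx1 p).1
        · intro σ _
          by_cases h : σ.IsReal
          · by_cases h' : σ ∈ 𝔪.inf
            · simp [hx2 σ h']
            · rcases hx3 σ h h' with a | a <;> simp [a]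
          · simp [hx4 σ (InfinitePlace.not_isReal_iff_isComplex.1 h)]
    exact fun x hx ↦ this hx)

/-- The kernel `C_𝔪¹` of the norm on `C_𝔪`. -/
def Modulus.normOne (𝔪 : Modulus F) : Subgroup 𝔪.IdeleClassGroup := 𝔪.norm.ker

/-- The finite group `(ℤ_F/𝔪)ˣ = (ℤ_F/𝔪_f)ˣ × ∏_{σ ∈ 𝔪_∞} {±1}`; the units of `SignType` are
`1` and `-1`. -/
abbrev Modulus.ResidueUnits (𝔪 : Modulus F) : Type _ := (𝓞 F ⧸ 𝔪.fin)ˣ × (𝔪.inf → SignTypeˣ)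
variable (F) in
/-- The ring `∏_𝔭 ℤ_𝔭`. -/
abbrev LocalIntegers := ∀ p : HeightOneSpectrum (𝓞 F), p.adicCompletionIntegers F

/-- The ideal `∏_𝔭 𝔭^{v_𝔭(𝔪_f)} ℤ_𝔭` of `∏_𝔭 ℤ_𝔭`. -/
def Modulus.localIdeal (𝔪 : Modulus F) : Ideal (LocalIntegers F) where
  carrier := {u | ∀ p, Valued.v (u p : p.adicCompletion F) ≤ WithZero.exp (-(𝔪.exponent p : ℤ))}
  zero_mem' := by simp
  add_mem' := by
    intro a b ha hb p
    exact Valuation.map_add_le _ (ha p) (hb p)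
  smul_mem' := by
    intro c a ha p
    have h1 : Valued.v (c p : p.adicCompletion F) ≤ 1 := (c p).2
    change Valued.v ((c p : p.adicCompletion F) * (a p : p.adicCompletion F)) ≤ _
    rw [map_mul]
    exact (mul_le_mul' h1 (ha p)).trans (by rw [one_mul])

variable (F) in
/-- The diagonal embedding of `ℤ_F` into `∏_𝔭 ℤ_𝔭`. -/
def toLocalIntegers : 𝓞 F →+* LocalIntegers F :=
  RingHom.pi fun p ↦ algebraMap (𝓞 F) (p.adicCompletionIntegers F)

theorem valued_toLocalIntegers (p : HeightOneSpectrum (𝓞 F)) (a : 𝓞 F) :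
    Valued.v (toLocalIntegers F a p : p.adicCompletion F) = p.intValuation a := by
  rw [← valuation_of_algebraMap (K := F)]
  exact valuedAdicCompletion_eq_valuation' p (a : F)

theorem Modulus.comap_localIdeal (𝔪 : Modulus F) :
    𝔪.localIdeal.comap (toLocalIntegers F) = 𝔪.fin := by
  ext a
  change (∀ p, _ ≤ _) ↔ _
  simp only [valued_toLocalIntegers, intValuation_le_pow_iff_mem]
  constructor
  · intro h
    rw [← Ideal.iInf_maxPowDividing_eq 𝔪.fin_ne_bot]
    simp only [Ideal.mem_iInf]
    intro p
    rw [maxPowDividing_eq_pow_multiplicity 𝔪.fin_ne_bot]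
    exact h p
  · intro h p
    exact Ideal.le_of_dvd (pow_multiplicity_dvd _ _) h

theorem exists_integer_close (p : HeightOneSpectrum (𝓞 F)) (u : p.adicCompletionIntegers F)
    (n : ℕ) : ∃ a : 𝓞 F, Valued.v ((u : p.adicCompletion F) - ((a : F) : p.adicCompletion F)) ≤
      WithZero.exp (-(n : ℤ)) := by
  have hne : (WithZero.exp (-(n : ℤ)) : ℤᵐ⁰) ≠ 0 := WithZero.exp_ne_zero
  have hle : (WithZero.exp (-(n : ℤ)) : ℤᵐ⁰) ≤ 1 := by
    rw [← WithZero.exp_zero, WithZero.exp_le_exp]; omega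
  obtain ⟨π, hπ⟩ := valuedAdicCompletion_surjective F p (WithZero.exp (-(n : ℤ)))
  have hopen : {z : p.adicCompletion F | Valued.v (z - u) < Valued.v π} ∈
      nhds (u : p.adicCompletion F) := by
    have hπ0 : Valued.v.restrict π ≠ 0 := by
      rw [Valuation.ne_zero_iff]
      rintro rfl
      rw [map_zero] at hπ
      exact hne hπ.symm
    exact Valued.mem_nhds.2 ⟨Units.mk0 _ hπ0, fun y hy ↦ (Valuation.restrict_lt_iff _).1 hy⟩
  obtain ⟨x, hx⟩ := (p.denseRange_algebraMap (K := F)).exists_mem_open isOpen_interior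
    ⟨_, mem_interior_iff_mem_nhds.2 hopen⟩
  have hx' : Valued.v ((x : p.adicCompletion F) - u) < WithZero.exp (-(n : ℤ)) := by
    have h : (algebraMap F (p.adicCompletion F) x) ∈ {z : p.adicCompletion F |
      Valued.v (z - u) < Valued.v π} := interior_subset hx
    rw [← hπ]; exact h
  have hxint : p.valuation F x ≤ 1 := by
    rw [← valuedAdicCompletion_eq_valuation']
    have : (x : p.adicCompletion F) = (x - u) + u := by ring
    rw [this]
    exact Valuation.map_add_le _ (hx'.le.trans hle) u.2
  obtain ⟨a, ha⟩ := exists_valuation_sub_lt_of_integer p hxint (Units.mk0 _ hne)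
  refine ⟨a, ?_⟩
  have : (u : p.adicCompletion F) - ((a : F) : p.adicCompletion F) =
      -((x : p.adicCompletion F) - u) - (((a : F) - x : F) : p.adicCompletion F) := by
    have : (((a : F) - x : F) : p.adicCompletion F) =
      ((a : F) : p.adicCompletion F) - (x : p.adicCompletion F) :=
        (algebraMap F (p.adicCompletion F)).map_sub _ _
    rw [this]; ring
  rw [this]
  refine (Valuation.map_sub _ _ _).trans (max_le ?_ ?_)
  · rw [Valuation.map_neg]; exact hx'.le
  · rw [valuedAdicCompletion_eq_valuation']; exact ha.le

theorem Modulus.quot_surjective (𝔪 : Modulus F) (u : LocalIntegers F) :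
    ∃ a : 𝓞 F, u - toLocalIntegers F a ∈ 𝔪.localIdeal := by
  classical
  have hfin : {p : HeightOneSpectrum (𝓞 F) | p.asIdeal ∣ 𝔪.fin}.Finite :=
    Ideal.finite_factors 𝔪.fin_ne_bot
  choose b hb using fun p ↦ exists_integer_close p (u p) (𝔪.exponent p)
  obtain ⟨y, hy⟩ := IsDedekindDomain.exists_forall_sub_mem_ideal (s := hfin.toFinset)
    (fun p : HeightOneSpectrum (𝓞 F) ↦ p.asIdeal) 𝔪.exponent (fun p _ ↦ p.prime)
    (fun p _ q _ hpq h ↦ hpq (HeightOneSpectrum.ext h)) (fun p ↦ b p)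
  refine ⟨y, fun p ↦ ?_⟩
  by_cases hp : p.asIdeal ∣ 𝔪.fin
  · have h1 := hy p (by simpa using hp)
    rw [← intValuation_le_pow_iff_mem, ← valued_toLocalIntegers] at h1
    have : ((u - toLocalIntegers F y) p : p.adicCompletion F) =
        ((u p : p.adicCompletion F) - ((b p : F) : p.adicCompletion F)) -
          (toLocalIntegers F (y - b p) p : p.adicCompletion F) := by
      rw [map_sub]
      change (u p : p.adicCompletion F) - ((y : F) : p.adicCompletion F) = _ - (((y : F) : p.adicCompletion F) - ((b p : F) : p.adicCompletion F))
      ring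
    rw [this]
    exact (Valuation.map_sub _ _ _).trans (max_le (hb p) h1)
  · have : 𝔪.exponent p = 0 := multiplicity_eq_zero.2 hp
    rw [this]
    exact ((u - toLocalIntegers F y) p).2

/-- The isomorphism `ℤ_F/𝔪_f ≅ ∏_𝔭 ℤ_𝔭/𝔭^{v_𝔭(𝔪_f)}` induced by the diagonal embedding. -/
def Modulus.quotEquiv (𝔪 : Modulus F) : (𝓞 F ⧸ 𝔪.fin) ≃+* (LocalIntegers F ⧸ 𝔪.localIdeal) :=
  RingEquiv.ofBijective
    (Ideal.quotientMap 𝔪.localIdeal (toLocalIntegers F) 𝔪.comap_localIdeal.ge)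
    ⟨Ideal.quotientMap_injective' 𝔪.comap_localIdeal.le, by
      intro z
      obtain ⟨u, rfl⟩ := Ideal.Quotient.mk_surjective z
      obtain ⟨a, ha⟩ := 𝔪.quot_surjective u
      exact ⟨Ideal.Quotient.mk _ a, by
        rw [Ideal.quotientMap_mk]; exact (Ideal.Quotient.eq.2 ha).symm⟩⟩

/-- The reduction `u ↦ u mod 𝔪_f` from `∏_𝔭 ℤ_𝔭ˣ` to `(ℤ_F/𝔪_f)ˣ`. -/
def Modulus.reduce (𝔪 : Modulus F) : (LocalIntegers F)ˣ →* (𝓞 F ⧸ 𝔪.fin)ˣ :=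
  Units.map (𝔪.quotEquiv.symm.toRingHom.comp (Ideal.Quotient.mk 𝔪.localIdeal)).toMonoidHom

/-- The valuation `v_𝔭(x_𝔭) ∈ ℤ` of the component at `𝔭` of an idèle. -/
def val (p : HeightOneSpectrum (𝓞 F)) (x : Ideles F) : ℤ := -WithZero.log (Valued.v (finComp p x))

theorem val_one (p : HeightOneSpectrum (𝓞 F)) : val p (1 : Ideles F) = 0 := by simp [val]

theorem val_mul (p : HeightOneSpectrum (𝓞 F)) (x y : Ideles F) :
    val p (x * y) = val p x + val p y := by
  have hx := (Valuation.ne_zero_iff Valued.v).2 (finComp_ne_zero p x)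
  have hy := (Valuation.ne_zero_iff Valued.v).2 (finComp_ne_zero p y)
  rw [val, map_mul, map_mul, WithZero.log_mul hx hy, val, val]; ring

/-- The group `U_S` of `S`-idèles. -/
def sIdeles (S : Finset (HeightOneSpectrum (𝓞 F))) : Subgroup (Ideles F) where
  carrier := {x | ∀ p, p ∉ S → Valued.v (finComp p x) = 1}
  one_mem' := by simp
  mul_mem' := by
    intro x y hx hy p hp
    simp [hx p hp, hy p hp]
  inv_mem' := by
    intro x hx p hp
    have : finComp p x⁻¹ = (finComp p x)⁻¹ := eq_inv_of_mul_eq_one_left (by rw [← map_mul]; simp)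
    simp [this, hx p hp]

/-- The set `S` of primes generates the class group of `F`. -/
def GeneratesClassGroup (S : Finset (HeightOneSpectrum (𝓞 F))) : Prop :=
  Subgroup.closure
    ((fun p : HeightOneSpectrum (𝓞 F) ↦
      ClassGroup.mk0 ⟨p.asIdeal, mem_nonZeroDivisors_of_ne_zero p.ne_bot⟩) '' S) =
        (⊤ : Subgroup (ClassGroup (𝓞 F)))

variable (F) in
/-- The choices on which the logarithm maps depend: a finite set `S` of primes generating the
class group, a uniformizer at every prime, and an isomorphism
`log_𝔪 : (ℤ_F/𝔪)ˣ ≅ ℤ^r/Λ_𝔪` (so that `Λ_𝔪` is a full sublattice of `ℤ^r`). -/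
structure LogData (𝔪 : Modulus F) where
  S : Finset (HeightOneSpectrum (𝓞 F))
  S_generates : GeneratesClassGroup S
  unif : ∀ p : HeightOneSpectrum (𝓞 F), p.adicCompletion F
  valued_unif : ∀ p, Valued.v (unif p) = WithZero.exp (-1 : ℤ)
  r : ℕ
  latticeM : AddSubgroup (Fin r → ℤ)
  logM : 𝔪.ResidueUnits ≃* Multiplicative ((Fin r → ℤ) ⧸ latticeM)

namespace LogData

variable {𝔪 : Modulus F} (D : LogData F 𝔪)

theorem unif_ne_zero (p : HeightOneSpectrum (𝓞 F)) : D.unif p ≠ 0 := by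
  intro h
  have := D.valued_unif p
  rw [h, map_zero] at this
  exact WithZero.exp_ne_zero this.symm

theorem valued_unitPart (p : HeightOneSpectrum (𝓞 F)) (x : Ideles F) :
    Valued.v (finComp p x * D.unif p ^ (-val p x)) = 1 := by
  have hx := (Valuation.ne_zero_iff Valued.v).2 (finComp_ne_zero p x)
  rw [map_mul, map_zpow₀, D.valued_unif, val, neg_neg]
  nth_rw 1 [← WithZero.exp_log hx]
  rw [← WithZero.exp_zsmul, ← WithZero.exp_add]
  simp

/-- The units `u_𝔭 = x_𝔭 π_𝔭^{-v_𝔭(x_𝔭)}` of `ℤ_𝔭` attached to an idèle. -/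
def unitPart : Ideles F →* (LocalIntegers F)ˣ :=
  MonoidHom.toHomUnits
    { toFun := fun x p ↦ ⟨finComp p x * D.unif p ^ (-val p x), (D.valued_unitPart p x).le⟩
      map_one' := by
        funext p
        apply Subtype.ext
        simp [val_one]
      map_mul' := by
        intro x y
        funext p
        apply Subtype.ext
        change finComp p (x * y) * D.unif p ^ (-val p (x * y)) =
          (finComp p x * D.unif p ^ (-val p x)) * (finComp p y * D.unif p ^ (-val p y))
        rw [val_mul, map_mul, neg_add, zpow_add₀ (D.unif_ne_zero p)]
        ring }

/-- The component in `(ℤ_F/𝔪)ˣ` of the decomposition of an idèle: the class of `u` modulo `𝔪_f`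
and the signs at the places of `𝔪_∞`. -/
def residue : Ideles F →* 𝔪.ResidueUnits :=
  (𝔪.reduce.comp D.unitPart).prod <| MonoidHom.pi fun σ ↦
    (Units.map (signHom : ℝ →*₀ SignType).toMonoidHom).comp <|
      ((InfinitePlace.Completion.extensionEmbeddingOfIsReal
        (𝔪.inf_isReal σ.1 σ.2)).toMonoidHom.comp (infComp σ.1)).toHomUnits

/-- The group `ℤ^ℓ × ℝ^n`, where `ℓ = #S + r` and `n = (r₁ + r₂) + r₂`, with the factors
in the order: primes in `S`, generators of `(ℤ_F/𝔪)ˣ`, archimedean places (moduli), complex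
places (arguments). -/
abbrev Coord : Type _ :=
  (D.S → ℤ) × (Fin D.r → ℤ) × (InfinitePlace F → ℝ) × ({σ : InfinitePlace F // σ.IsComplex} → ℝ)

/-- The subgroup `Λ_𝔪 + ℤ^{r₂}` of `ℤ^ℓ × ℝ^n`. -/
def baseLattice : AddSubgroup D.Coord :=
  AddSubgroup.prod ⊥ <| D.latticeM.prod <| AddSubgroup.prod ⊥ <|
    AddSubgroup.pi Set.univ fun _ ↦ (Int.castAddHom ℝ).range

/-- The embedding of `ℤ^r/Λ_𝔪` in `(ℤ^ℓ × ℝ^n)/(Λ_𝔪 + ℤ^{r₂})`. -/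
def embedM : (Fin D.r → ℤ) ⧸ D.latticeM →+ D.Coord ⧸ D.baseLattice :=
  QuotientAddGroup.map D.latticeM D.baseLattice
    ((AddMonoidHom.inr _ _).comp (AddMonoidHom.inl _ _))
    (fun b hb ↦ ⟨rfl, hb, rfl, fun _ _ ↦ ⟨0, by simp⟩⟩)

/-- The vector with entries `v_𝔭(x_𝔭)` for `𝔭 ∈ S`, then `0`, then `n_σ/(2π) log |x_σ|` for all
`σ`, then `arg(x_σ)/(2π)` for `σ` complex. -/
def rawLog (x : Ideles F) : D.Coord :=
  (fun p ↦ val p.1 x, 0,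
    fun σ ↦ (σ.mult : ℝ) / (2 * Real.pi) * Real.log ‖infComp σ x‖,
    fun σ ↦ Complex.arg (InfinitePlace.Completion.extensionEmbedding σ.1 (infComp σ.1 x)) /
      (2 * Real.pi))

theorem rawLog_one : D.rawLog 1 = 0 := by
  simp [rawLog, val_one]
  exact ⟨rfl, rfl, rfl⟩

theorem rawLog_mul (x y : Ideles F) :
    ((D.rawLog (x * y) : D.Coord) : D.Coord ⧸ D.baseLattice) = D.rawLog x + D.rawLog y := by
  rw [← QuotientAddGroup.mk_add, QuotientAddGroup.eq]
  refine ⟨?_, ?_, ?_, ?_⟩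
  · change _ = (0 : D.S → ℤ)
    funext p
    simp [rawLog, val_mul]
  · change _ ∈ D.latticeM
    simp [rawLog, D.latticeM.zero_mem]
  · change _ = (0 : InfinitePlace F → ℝ)
    funext σ
    have hx := norm_ne_zero_iff.2 (infComp_ne_zero σ x)
    have hy := norm_ne_zero_iff.2 (infComp_ne_zero σ y)
    simp [rawLog, Real.log_mul hx hy]
    ring
  · intro σ _
    have hx := (map_ne_zero (InfinitePlace.Completion.extensionEmbedding σ.1)).2
      (infComp_ne_zero σ.1 x)
    have hy := (map_ne_zero (InfinitePlace.Completion.extensionEmbedding σ.1)).2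
      (infComp_ne_zero σ.1 y)
    have h := Complex.arg_mul_coe_angle hx hy
    rw [← Real.Angle.coe_add, Real.Angle.angle_eq_iff_two_pi_dvd_sub, ← map_mul, ← map_mul] at h
    obtain ⟨k, hk⟩ := h
    refine ⟨-k, ?_⟩
    simp only [rawLog, Int.coe_castAddHom, Prod.snd_add, Prod.snd_neg, Pi.add_apply, Pi.neg_apply]
    have := Real.pi_pos
    field_simp
    push_cast
    linarith

/-- The logarithm `ℒ_S : U_S → (ℤ^ℓ × ℝ^n)/(Λ_𝔪 + ℤ^{r₂})`. -/
def logS : sIdeles D.S →* Multiplicative (D.Coord ⧸ D.baseLattice) where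
  toFun x := Multiplicative.ofAdd
    ((D.rawLog x : D.Coord ⧸ D.baseLattice) + D.embedM (D.logM (D.residue x)).toAdd)
  map_one' := by simp [rawLog_one]
  map_mul' x y := by
    rw [← ofAdd_add]
    congr 1
    rw [Subgroup.coe_mul, rawLog_mul, map_mul, map_mul, toAdd_mul, map_add]
    abel

/-- The lattice `Λ = ℒ_S(ℤ_{F,S}ˣ) + Λ_𝔪 + ℤ^{r₂}`, where `ℤ_{F,S}ˣ = Fˣ ∩ U_S`. -/
def lattice : AddSubgroup D.Coord :=
  (Subgroup.toAddSubgroup' (((diag F).range.subgroupOf (sIdeles D.S)).map D.logS)).comap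
    (QuotientAddGroup.mk' D.baseLattice)

theorem baseLattice_le : D.baseLattice ≤ D.lattice := by
  intro y hy
  have : QuotientAddGroup.mk' D.baseLattice y = 0 := (QuotientAddGroup.eq_zero_iff y).2 hy
  rw [lattice, AddSubgroup.mem_comap, this]
  exact zero_mem _

/-- The projection of `(ℤ^ℓ × ℝ^n)/(Λ_𝔪 + ℤ^{r₂})` onto `(ℤ^ℓ × ℝ^n)/Λ`. -/
def proj : D.Coord ⧸ D.baseLattice →+ D.Coord ⧸ D.lattice :=
  QuotientAddGroup.map _ _ (AddMonoidHom.id _) D.baseLattice_le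

theorem proj_logS (z : sIdeles D.S) (hz : (z : Ideles F) ∈ (diag F).range) :
    D.proj (D.logS z).toAdd = 0 := by
  obtain ⟨y, hy⟩ := QuotientAddGroup.mk_surjective (D.logS z).toAdd
  rw [← hy]
  change ((y : D.Coord) : D.Coord ⧸ D.lattice) = 0
  rw [QuotientAddGroup.eq_zero_iff, lattice, AddSubgroup.mem_comap, Subgroup.mem_toAddSubgroup']
  change Multiplicative.ofAdd (y : D.Coord ⧸ D.baseLattice) ∈ _
  rw [hy]
  exact ⟨z, hz, rfl⟩

theorem exists_ideal (S : Finset (HeightOneSpectrum (𝓞 F))) (hS : GeneratesClassGroup S)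
    (c : ClassGroup (𝓞 F)) :
    ∃ J : nonZeroDivisors (Ideal (𝓞 F)), ClassGroup.mk0 J = c ∧
      ∀ p : HeightOneSpectrum (𝓞 F), p ∉ S → ¬ p.asIdeal ∣ (J : Ideal (𝓞 F)) := by
  have hc : c ∈ Subgroup.closure ((fun p : HeightOneSpectrum (𝓞 F) ↦
      ClassGroup.mk0 ⟨p.asIdeal, mem_nonZeroDivisors_of_ne_zero p.ne_bot⟩) '' S) := by
    rw [GeneratesClassGroup] at hS; rw [hS]; trivial
  induction hc using Subgroup.closure_induction with
  | mem c hc =>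
    obtain ⟨q, hq, rfl⟩ := hc
    refine ⟨_, rfl, fun p hp hdvd ↦ hp ?_⟩
    have : q = p := HeightOneSpectrum.ext
      (q.isMaximal.eq_of_le p.isPrime.ne_top (Ideal.le_of_dvd hdvd))
    exact this ▸ hq
  | one => exact ⟨1, map_one _, fun p _ h ↦ p.prime.not_isUnit (isUnit_of_dvd_one h)⟩
  | mul c d _ _ hc hd =>
    obtain ⟨I, rfl, hI⟩ := hc
    obtain ⟨J, rfl, hJ⟩ := hd
    exact ⟨I * J, map_mul _ _ _, fun p hp h ↦
      (p.prime.dvd_or_dvd h).elim (hI p hp) (hJ p hp)⟩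
  | inv c _ hc =>
    obtain ⟨I, rfl, hI⟩ := hc
    refine ⟨I ^ (Fintype.card (ClassGroup (𝓞 F)) - 1), ?_, fun p hp h ↦
      hI p hp (p.prime.dvd_of_dvd_pow h)⟩
    rw [map_pow]
    refine eq_inv_of_mul_eq_one_left ?_
    rw [← pow_succ, Nat.sub_add_cancel Fintype.card_pos, pow_card_eq_one]

theorem exists_generator (S : Finset (HeightOneSpectrum (𝓞 F))) (hS : GeneratesClassGroup S)
    (p : HeightOneSpectrum (𝓞 F)) :
    ∃ γ : Fˣ, (p ∉ S → p.valuation F γ = WithZero.exp (-1 : ℤ)) ∧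
      ∀ q : HeightOneSpectrum (𝓞 F), q ∉ S → q ≠ p → q.valuation F γ = 1 := by
  obtain ⟨J, hJ, hJS⟩ := exists_ideal S hS
    (ClassGroup.mk0 ⟨p.asIdeal, mem_nonZeroDivisors_of_ne_zero p.ne_bot⟩)⁻¹
  have h1 : ClassGroup.mk0 (⟨p.asIdeal, mem_nonZeroDivisors_of_ne_zero p.ne_bot⟩ * J) = 1 := by
    rw [map_mul, hJ, mul_inv_cancel]
  rw [ClassGroup.mk0_eq_one_iff] at h1
  obtain ⟨g, hg⟩ := h1
  have hg' : p.asIdeal * (J : Ideal (𝓞 F)) = Ideal.span {g} := hg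
  have hJ0 : (J : Ideal (𝓞 F)) ≠ 0 := nonZeroDivisors.coe_ne_zero J
  have hg0 : g ≠ 0 := by
    rintro rfl
    have : p.asIdeal * (J : Ideal (𝓞 F)) = 0 := by rw [hg']; simp
    exact (mul_ne_zero p.ne_bot hJ0) this
  refine ⟨Units.mk0 (g : F) (by simpa using hg0), fun hp ↦ ?_, fun q hq hqp ↦ ?_⟩
  · rw [Units.val_mk0, valuation_of_algebraMap]
    have hle : p.intValuation g ≤ WithZero.exp (-((1 : ℕ) : ℤ)) := by
      rw [intValuation_le_pow_iff_dvd, ← hg', pow_one]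
      exact dvd_mul_right _ _
    have hnle : ¬ p.intValuation g ≤ WithZero.exp (-((2 : ℕ) : ℤ)) := by
      rw [intValuation_le_pow_iff_dvd, ← hg', pow_two]
      intro h
      exact hJS p hp ((mul_dvd_mul_iff_left p.ne_bot).1 h)
    have hne : p.intValuation g ≠ 0 := p.intValuation_ne_zero g hg0
    rw [← WithZero.exp_log hne] at hle hnle ⊢
    rw [WithZero.exp_le_exp] at hle hnle
    congr 1
    push_cast at hle hnle
    omega
  · rw [Units.val_mk0, valuation_of_algebraMap, intValuation_eq_one_iff]
    rw [← Ideal.dvd_span_singleton, ← hg']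
    intro h
    rcases q.prime.dvd_or_dvd h with h | h
    · exact hqp (HeightOneSpectrum.ext (p.isMaximal.eq_of_le q.isPrime.ne_top
        (Ideal.le_of_dvd h)).symm)
    · exact hJS q hq h

/-- If `S` generates the class group, then `𝔸_Fˣ = U_S · Fˣ`. -/
theorem exists_sIdele (x : Ideles F) : ∃ α : Fˣ, x * (diag F α)⁻¹ ∈ sIdeles D.S := by
  choose γ hγ hγ' using exists_generator D.S D.S_generates
  have hfin : {p | Valued.v (finComp p x) ≠ 1}.Finite := by
    simpa [Filter.eventually_cofinite] using finComp_eventually x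
  refine ⟨∏ p ∈ hfin.toFinset, γ p ^ val p x, fun q hq ↦ ?_⟩
  have hx := (Valuation.ne_zero_iff Valued.v).2 (finComp_ne_zero q x)
  have hα : q.valuation F ((∏ p ∈ hfin.toFinset, γ p ^ val p x : Fˣ) : F) =
      Valued.v (finComp q x) := by
    rw [Units.coe_prod, map_prod, Finset.prod_eq_single q]
    · rw [Units.val_zpow_eq_zpow_val, map_zpow₀, hγ q hq, ← WithZero.exp_zsmul, val]
      simp [WithZero.exp_log hx]
    · intro p _ hpq
      rw [Units.val_zpow_eq_zpow_val, map_zpow₀, hγ' p q hq hpq.symm, one_zpow]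
    · intro h
      have h1 : Valued.v (finComp q x) = 1 := by simpa using h
      simp [val, h1]
  have hmul : finComp q (x * (diag F (∏ p ∈ hfin.toFinset, γ p ^ val p x))⁻¹) *
      finComp q (diag F (∏ p ∈ hfin.toFinset, γ p ^ val p x)) = finComp q x := by
    rw [← map_mul, inv_mul_cancel_right]
  have hv : Valued.v (finComp q (diag F (∏ p ∈ hfin.toFinset, γ p ^ val p x))) =
      Valued.v (finComp q x) := by
    rw [← hα]; exact valuedAdicCompletion_eq_valuation' q _
  have h := congrArg Valued.v hmul
  rw [map_mul, hv] at h
  exact mul_right_cancel₀ hx (h.trans (one_mul _).symm)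

theorem proj_logS_congr (x y : Ideles F) (α : Fˣ) (hx : x ∈ sIdeles D.S) (hy : y ∈ sIdeles D.S)
    (h : x = y * diag F α) :
    D.proj (D.logS ⟨x, hx⟩).toAdd = D.proj (D.logS ⟨y, hy⟩).toAdd := by
  have hmem : diag F α ∈ sIdeles D.S := by
    have : diag F α = y⁻¹ * x := by rw [h]; group
    rw [this]; exact mul_mem (inv_mem hy) hx
  have : (⟨x, hx⟩ : sIdeles D.S) = ⟨y, hy⟩ * ⟨diag F α, hmem⟩ := Subtype.ext h
  rw [this, map_mul, toAdd_mul, map_add, D.proj_logS ⟨_, hmem⟩ ⟨α, rfl⟩, add_zero]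

/-- The logarithm `ℒ : 𝔸_Fˣ → (ℤ^ℓ × ℝ^n)/Λ`, defined by `ℒ(x) = ℒ_S(x α⁻¹)` for any `α ∈ Fˣ`
such that `x α⁻¹ ∈ U_S`. -/
def logIdele : Ideles F →* Multiplicative (D.Coord ⧸ D.lattice) where
  toFun x := Multiplicative.ofAdd (D.proj (D.logS ⟨_, (D.exists_sIdele x).choose_spec⟩).toAdd)
  map_one' := by
    rw [ofAdd_eq_one]
    exact D.proj_logS _ ⟨(D.exists_sIdele 1).choose⁻¹, by rw [map_inv]; exact (one_mul _).symm⟩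
  map_mul' x y := by
    rw [← ofAdd_add, ← map_add, ← toAdd_mul, ← map_mul]
    congr 1
    refine D.proj_logS_congr _ _ ((D.exists_sIdele x).choose * (D.exists_sIdele y).choose *
      (D.exists_sIdele (x * y)).choose⁻¹) (D.exists_sIdele (x * y)).choose_spec
      (mul_mem (D.exists_sIdele x).choose_spec (D.exists_sIdele y).choose_spec) ?_
    change _ = x * (diag F (D.exists_sIdele x).choose)⁻¹ *
      (y * (diag F (D.exists_sIdele y).choose)⁻¹) * _
    rw [map_mul, map_mul, map_inv]
    generalize diag F (D.exists_sIdele x).choose = a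
    generalize diag F (D.exists_sIdele y).choose = b
    generalize diag F (D.exists_sIdele (x * y)).choose = c
    have h : x * a⁻¹ * (y * b⁻¹) * (a * b * c⁻¹) = x * y * c⁻¹ * (a⁻¹ * a) * (b⁻¹ * b) := by ac_rfl
    rw [h]; simp

theorem logIdele_apply (x : Ideles F) (α : Fˣ) (h : x * (diag F α)⁻¹ ∈ sIdeles D.S) :
    D.logIdele x = Multiplicative.ofAdd (D.proj (D.logS ⟨_, h⟩).toAdd) := by
  refine congrArg Multiplicative.ofAdd
    (D.proj_logS_congr _ _ (α * (D.exists_sIdele x).choose⁻¹) _ _ ?_)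
  rw [map_mul, map_inv]
  generalize diag F (D.exists_sIdele x).choose = a
  have : x * (diag F α)⁻¹ * (diag F α * a⁻¹) = x * a⁻¹ * ((diag F α)⁻¹ * diag F α) := by ac_rfl
  rw [this]; simp

theorem residue_congrOne (x : Ideles F) (hx : x ∈ 𝔪.congrOne) : D.residue x = 1 := by
  obtain ⟨hx1, hx2, hx3, hx4⟩ := hx
  refine Prod.ext ?_ ?_
  · change 𝔪.reduce (D.unitPart x) = 1
    apply Units.ext
    change 𝔪.quotEquiv.symm (Ideal.Quotient.mk _ (D.unitPart x : LocalIntegers F)) = 1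
    have : Ideal.Quotient.mk 𝔪.localIdeal (D.unitPart x : LocalIntegers F) = 1 := by
      rw [← map_one (Ideal.Quotient.mk 𝔪.localIdeal), Ideal.Quotient.eq]
      intro p
      have h0 : val p x = 0 := by simp [val, (hx1 p).1]
      change Valued.v (finComp p x * D.unif p ^ (-val p x) - 1) ≤ _
      rw [h0]
      simpa using (hx1 p).2
    rw [this, map_one]
  · funext σ
    apply Units.ext
    change SignType.sign (InfinitePlace.Completion.extensionEmbeddingOfIsReal
      (𝔪.inf_isReal σ.1 σ.2) (infComp σ.1 x)) = 1
    rw [hx2 σ.1 σ.2, map_one, sign_one]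

theorem rawLog_congrOne (x : Ideles F) (hx : x ∈ 𝔪.congrOne) : D.rawLog x = 0 := by
  obtain ⟨hx1, hx2, hx3, hx4⟩ := hx
  refine Prod.ext ?_ (Prod.ext rfl (Prod.ext ?_ ?_))
  · funext p
    change val p.1 x = 0
    simp [val, (hx1 p.1).1]
  · funext σ
    change (σ.mult : ℝ) / (2 * Real.pi) * Real.log ‖infComp σ x‖ = 0
    have : ‖infComp σ x‖ = 1 := by
      by_cases h : σ.IsReal
      · by_cases h' : σ ∈ 𝔪.inf
        · simp [hx2 σ h']
        · rcases hx3 σ h h' with a | a <;> simp [a]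
      · simp [hx4 σ (InfinitePlace.not_isReal_iff_isComplex.1 h)]
    simp [this]
  · funext σ
    change Complex.arg (InfinitePlace.Completion.extensionEmbedding σ.1 (infComp σ.1 x)) /
      (2 * Real.pi) = 0
    simp [hx4 σ.1 σ.2]

theorem logIdele_kernel (x : Ideles F) (hx : x ∈ 𝔪.kernel) : D.logIdele x = 1 := by
  have : 𝔪.kernel ≤ D.logIdele.ker := by
    refine sup_le ?_ ?_
    · rintro _ ⟨α, rfl⟩
      rw [MonoidHom.mem_ker, D.logIdele_apply _ α (by simp [one_mem]), ofAdd_eq_one]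
      exact D.proj_logS _ ⟨1, by simp⟩
    · intro x hx
      have h : x * (diag F 1)⁻¹ ∈ sIdeles D.S := by
        rw [map_one, inv_one, mul_one]
        exact fun p _ ↦ (hx.1 p).1
      have hx' : x * (diag F 1)⁻¹ ∈ 𝔪.congrOne := by
        rwa [map_one, inv_one, mul_one]
      rw [MonoidHom.mem_ker, D.logIdele_apply _ 1 h, ofAdd_eq_one]
      have : (D.logS ⟨_, h⟩).toAdd = 0 := by
        change (D.rawLog (x * (diag F 1)⁻¹) : D.Coord ⧸ D.baseLattice) +
          D.embedM (D.logM (D.residue (x * (diag F 1)⁻¹))).toAdd = 0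
        rw [D.rawLog_congrOne _ hx', D.residue_congrOne _ hx']
        simp
      rw [this, map_zero]
  exact this hx

/-- The logarithm `ℒ : C_𝔪 → (ℤ^ℓ × ℝ^n)/Λ`. -/
def log : 𝔪.IdeleClassGroup →* Multiplicative (D.Coord ⧸ D.lattice) :=
  QuotientGroup.lift 𝔪.kernel D.logIdele D.logIdele_kernel

/-! ### Euclidean space and the orthogonal projection -/

/-- The index set of the coordinates of `ℝ^{ℓ+n}`. -/
abbrev Index : Type _ :=
  D.S ⊕ Fin D.r ⊕ InfinitePlace F ⊕ {σ : InfinitePlace F // σ.IsComplex}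

instance : Fintype D.Index := Fintype.ofFinite _

/-- The space `ℝ^{ℓ+n}` with its standard inner product. -/
abbrev Space : Type _ := EuclideanSpace ℝ D.Index

/-- The inclusion of `ℤ^ℓ × ℝ^n` in `ℝ^{ℓ+n}`. -/
def toSpace : D.Coord →+ D.Space where
  toFun y := WithLp.toLp 2 (Sum.elim (fun p ↦ (y.1 p : ℝ)) <| Sum.elim (fun i ↦ (y.2.1 i : ℝ)) <|
    Sum.elim y.2.2.1 y.2.2.2)
  map_zero' := by
    ext (i | i | i | i) <;> simp
  map_add' x y := by
    ext (i | i | i | i) <;> simp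

/-- The vector `v₀`, with entry `n_σ` at the coordinate of modulus type at `σ` and `0`
elsewhere. -/
def normVector : D.Space := D.toSpace (0, 0, fun σ ↦ (σ.mult : ℝ), 0)

/-- The hyperplane `(ℝ v₀)^⊥`. -/
abbrev Hyperplane : Submodule ℝ D.Space := (ℝ ∙ D.normVector)ᗮ

/-- The orthogonal projection `p₀ : ℝ^{ℓ+n} → (ℝ v₀)^⊥`. -/
def p₀ : D.Space →L[ℝ] D.Hyperplane := D.Hyperplane.orthogonalProjectionOnto

/-- The projection `p₀(Λ)` of the lattice `Λ`. -/
def projLattice : Submodule ℤ D.Hyperplane :=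
  AddSubgroup.toIntSubmodule
    (D.lattice.map ((D.p₀ : D.Space →+ D.Hyperplane).comp D.toSpace))

/-- The dual lattice `p₀(Λ)^∨ = {w ∈ (ℝ v₀)^⊥ | ⟪w, y⟫ ∈ ℤ for all y ∈ p₀(Λ)}`. -/
def dualLattice : Submodule ℤ D.Hyperplane :=
  LinearMap.BilinForm.dualSubmodule (innerₗ D.Hyperplane) D.projLattice

/-- The subgroup `ℤ^ℓ` of `(ℝ v₀)^⊥`: the vectors with integral entries at the first `ℓ`
coordinates and `0` elsewhere. -/
def integral : Submodule ℤ D.Hyperplane :=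
  AddSubgroup.toIntSubmodule <|
    (AddSubgroup.map D.toSpace (AddSubgroup.prod ⊤ (AddSubgroup.prod ⊤ ⊥))).comap
      (D.Hyperplane.subtype : D.Hyperplane →+ D.Space)

end LogData

end Hecke
end

/-!
The theorem follows from the fact that `ℒ` identifies `C_𝔪` with `(ℤ^ℓ × ℝ^n)/Λ` as topological
groups, so that `C_𝔪¹` becomes the quotient by `p₀(Λ)` of the image of `ℤ^ℓ × ℝ^n` in `(ℝ v₀)^⊥`.

The logarithm is injective, because an `S`-idèle whose logarithm vanishes lies in `U(𝔪)`
(`mem_kernel_of_logIdele_eq_one`). It has a continuous section: the real coordinates are realised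
by exponentials at the archimedean places, and the integral coordinates by a choice of one idèle
for every basis vector (`exists_section`). The kernel of the norm is a complement of the line
through `v₀` on which the norm is the exponential of an explicit linear form; correcting the section
along that line gives a continuous surjection from `ℤ^ℓ × ℝ^n` to `C_𝔪¹` that is trivial on `v₀`
(`exists_section_normOne`). In the other direction, the logarithm is continuous at `1`, where only
the archimedean components contribute, and this suffices for the continuity of the characters
attached to the dual lattice (`continuous_latticeCharacter_log`).

That `p₀(Λ)` is a lattice is a form of Dirichlet's theorem for `S`-units. It spans, because a vector
of the hyperplane orthogonal to `Λ` is zero: the finite index of `Λ_𝔪` deals with the coordinates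
in `ℤ^r`, the lattice `ℤ^{r₂}` with the arguments, Dirichlet's unit theorem with the moduli, and
the finiteness of the class group with the coordinates in `S` (`span_projLattice`). It is discrete,
because an element of `Λ` with small projection has no integral coordinates, hence comes from a
unit, and by the product formula this unit has bounded absolute values, which leaves finitely many
possibilities (`finite_projLattice_inter_ball`).

Consequently `C_𝔪¹` is the image of a compact set (`compactSpace_normOne`), so its dual is discrete,
and only the abstract group remains to be found. A continuous character of `C_𝔪¹` pulls back to
one of `ℤ^ℓ × ℝ^n`, which is `y ↦ exp(2πi w·y)` for some `w` (`exists_inner_eq`); triviality on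
`ℝ v₀` and on `Λ` says that `w` lies in the dual lattice (`dualHom_surjective`), and the character
is trivial exactly when `w` is an integral vector (`dualHom_eq_zero_iff`).
-/

noncomputable section

/-! ### Characters of `ℤ^ℓ × ℝ^n` -/

namespace Hecke

/-- A continuous character of a real vector space lifts through `Circle.exp` to a continuous
linear form. -/
theorem exists_linear_lift {V : Type*} [NormedAddCommGroup V] [NormedSpace ℝ V] (ψ : V → Circle)
    (hψ : Continuous ψ) (hadd : ∀ x y, ψ (x + y) = ψ x * ψ y) :
    ∃ f : V →L[ℝ] ℝ, ∀ x, ψ x = Circle.exp (f x) := by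
  have h0 : ψ 0 = 1 := by simpa using hadd 0 0
  obtain ⟨f, ⟨hf0, hf⟩, -⟩ := Circle.isCoveringMap_exp.existsUnique_continuousMap_lifts
    ⟨ψ, hψ⟩ 0 0 (by simp [h0])
  have hf' : ∀ x, Circle.exp (f x) = ψ x := fun x ↦ congrFun hf x
  -- The defect of additivity is a second lift of the trivial character of `V × V`.
  have huniq := Circle.isCoveringMap_exp.existsUnique_continuousMap_lifts
    (⟨fun _ ↦ 1, continuous_const⟩ : C(V × V, Circle)) 0 0 (by simp)
  have key := huniq.unique (y₁ := ⟨fun p ↦ f (p.1 + p.2) - f p.1 - f p.2, by fun_prop⟩)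
    (y₂ := ⟨fun _ ↦ 0, continuous_const⟩)
    ⟨by simp [hf0], by
      funext p
      simp [sub_eq_add_neg, Circle.exp_add, Circle.exp_neg, hf', hadd]⟩
    ⟨rfl, by funext p; simp⟩
  have hfadd : ∀ x y, f (x + y) = f x + f y := fun x y ↦ by
    have := DFunLike.congr_fun key (x, y)
    simp only [ContinuousMap.coe_mk] at this
    linarith
  refine ⟨AddMonoidHom.toRealLinearMap ⟨⟨f, hf0⟩, hfadd⟩ f.continuous, fun x ↦ (hf' x).symm⟩

/-- A character of `ℤ^ι` is `a ↦ exp(2πi t·a)` for some `t ∈ ℝ^ι`. -/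
theorem exists_exp_eq_of_int {ι : Type*} [Fintype ι] (ψ : (ι → ℤ) → Circle)
    (hadd : ∀ x y, ψ (x + y) = ψ x * ψ y) :
    ∃ t : ι → ℝ, ∀ a, ψ a = Circle.exp (2 * Real.pi * ∑ i, t i * a i) := by
  classical
  choose t ht using fun i : ι ↦ Circle.exp_surjective (ψ (Pi.single i 1))
  let Ψ : (ι → ℤ) →+ Additive Circle := AddMonoidHom.mk' (fun a ↦ .ofMul (ψ a)) hadd
  let Φ : (ι → ℤ) →+ Additive Circle :=
    AddMonoidHom.mk' (fun a ↦ .ofMul (Circle.exp (2 * Real.pi * ∑ i, t i / (2 * Real.pi) * a i)))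
      fun a b ↦ by
        rw [← ofMul_mul, ← Circle.exp_add, ← mul_add, ← Finset.sum_add_distrib]
        simp [mul_add]
  have h : Ψ = Φ := by
    refine AddMonoidHom.functions_ext' _ _ _ fun i ↦ AddMonoidHom.ext_int ?_
    have : 2 * Real.pi * (t i / (2 * Real.pi)) = t i := by field_simp
    change Additive.ofMul (ψ (Pi.single i 1)) = Additive.ofMul (Circle.exp _)
    rw [← ht i]
    simp [Pi.single_apply, this]
  exact ⟨fun i ↦ t i / (2 * Real.pi), fun a ↦ congrArg Additive.toMul (DFunLike.congr_fun h a)⟩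

/-- A continuous character of `ℝ^ι` is `x ↦ exp(2πi t·x)` for some `t ∈ ℝ^ι`. -/
theorem exists_exp_eq_of_real {ι : Type*} [Fintype ι] (ψ : (ι → ℝ) → Circle)
    (hψ : Continuous ψ) (hadd : ∀ x y, ψ (x + y) = ψ x * ψ y) :
    ∃ t : ι → ℝ, ∀ x, ψ x = Circle.exp (2 * Real.pi * ∑ i, t i * x i) := by
  classical
  obtain ⟨f, hf⟩ := exists_linear_lift ψ hψ hadd
  refine ⟨fun i ↦ f (fun j ↦ if i = j then 1 else 0) / (2 * Real.pi), fun x ↦ ?_⟩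
  rw [hf, ← ContinuousLinearMap.coe_coe, LinearMap.pi_apply_eq_sum_univ, Finset.mul_sum]
  congr 1
  refine Finset.sum_congr rfl fun i _ ↦ ?_
  simp only [ContinuousLinearMap.coe_coe, smul_eq_mul]
  field_simp

namespace LogData

variable {F : Type*} [Field F] [NumberField F] {𝔪 : Modulus F} (D : LogData F 𝔪)

theorem continuous_toSpace : Continuous D.toSpace := by
  refine (PiLp.continuous_toLp 2 _).comp (continuous_pi fun i ↦ ?_)
  have hcast : Continuous ((↑) : ℤ → ℝ) := continuous_of_discreteTopology
  rcases i with i | i | i | i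
  · exact hcast.comp ((continuous_apply i).comp continuous_fst)
  · exact hcast.comp ((continuous_apply i).comp (continuous_fst.comp continuous_snd))
  · exact (continuous_apply i).comp (continuous_fst.comp (continuous_snd.comp continuous_snd))
  · exact (continuous_apply i).comp (continuous_snd.comp (continuous_snd.comp continuous_snd))

open scoped Classical in
theorem inner_toSpace (w : D.Space) (y : D.Coord) :
    inner ℝ w (D.toSpace y) = (∑ p, w (.inl p) * y.1 p) + ((∑ i, w (.inr (.inl i)) * y.2.1 i) +
      ((∑ σ, w (.inr (.inr (.inl σ))) * y.2.2.1 σ) +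
        ∑ σ, w (.inr (.inr (.inr σ))) * y.2.2.2 σ)) := by
  have h : inner ℝ w (D.toSpace y) = ∑ i, w i * (D.toSpace y) i := by
    rw [PiLp.inner_apply]
    exact Finset.sum_congr rfl fun i _ ↦ by simp [mul_comm]
  rw [h]
  have hinst : LogData.instFintypeIndex D = instFintypeSum _ _ := Subsingleton.elim _ _
  rw [hinst, Fintype.sum_sum_type, Fintype.sum_sum_type, Fintype.sum_sum_type]
  simp [toSpace]

/-- Every continuous character of `ℤ^ℓ × ℝ^n` is `y ↦ exp(2πi w·y)` for a `w ∈ ℝ^{ℓ+n}`. -/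
theorem exists_inner_eq (ψ : D.Coord → Circle) (hψ : Continuous ψ)
    (hadd : ∀ x y, ψ (x + y) = ψ x * ψ y) :
    ∃ w : D.Space, ∀ y, ψ y = Circle.exp (2 * Real.pi * inner ℝ w (D.toSpace y)) := by
  classical
  obtain ⟨a, ha⟩ := exists_exp_eq_of_int (fun z : D.S → ℤ ↦ ψ (z, 0, 0, 0))
    fun x y ↦ by rw [← hadd]; simp
  obtain ⟨b, hb⟩ := exists_exp_eq_of_int (fun z : Fin D.r → ℤ ↦ ψ (0, z, 0, 0))
    fun x y ↦ by rw [← hadd]; simp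
  obtain ⟨c, hc⟩ := exists_exp_eq_of_real (fun z : InfinitePlace F → ℝ ↦ ψ (0, 0, z, 0))
    (hψ.comp (by fun_prop)) fun x y ↦ by rw [← hadd]; simp
  obtain ⟨d, hd⟩ := exists_exp_eq_of_real
    (fun z : {σ : InfinitePlace F // σ.IsComplex} → ℝ ↦ ψ (0, 0, 0, z))
    (hψ.comp (by fun_prop)) fun x y ↦ by rw [← hadd]; simp
  refine ⟨WithLp.toLp 2 (Sum.elim a (Sum.elim b (Sum.elim c d))), fun y ↦ ?_⟩
  have hy : y = (y.1, 0, 0, 0) +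
      ((0, y.2.1, 0, 0) + ((0, 0, y.2.2.1, 0) + (0, 0, 0, y.2.2.2))) := by
    ext <;> simp
  rw [inner_toSpace]
  simp only [mul_add, Circle.exp_add, Sum.elim_inl, Sum.elim_inr]
  rw [hy, hadd, hadd, hadd, ha, hb, hc, hd, ← hy]

end LogData

end Hecke

/-! ### The kernel of the logarithm -/

namespace Hecke

variable {F : Type*} [Field F] [NumberField F]

/-- A component of modulus `1` whose argument is a multiple of `2π` is trivial. -/
theorem infComp_eq_one_of_arg {σ : InfinitePlace F} {x : Ideles F}
    (hnorm : ‖infComp σ x‖ = 1) {k : ℤ}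
    (hk : (k : ℝ) = Complex.arg (InfinitePlace.Completion.extensionEmbedding σ (infComp σ x)) /
      (2 * Real.pi)) : infComp σ x = 1 := by
  set z := InfinitePlace.Completion.extensionEmbedding σ (infComp σ x) with hz
  have hz1 : ‖z‖ = 1 := by
    rw [hz, ← hnorm]
    exact (InfinitePlace.Completion.isometry_extensionEmbedding σ).norm_map_of_map_zero
      (map_zero _) _
  have hπ := Real.pi_pos
  have hlt := Complex.neg_pi_lt_arg z
  have hle := Complex.arg_le_pi z
  rw [eq_div_iff (by positivity)] at hk
  have hk0 : k = 0 := by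
    have h1 : (k : ℝ) < 1 := by nlinarith
    have h2 : (-1 : ℝ) < k := by nlinarith
    have h3 : k < 1 := by exact_mod_cast h1
    have h4 : -1 < k := by exact_mod_cast h2
    omega
  have harg : Complex.arg z = 0 := by rw [← hk, hk0]; simp
  have : z = 1 := by
    rw [← Complex.norm_mul_exp_arg_mul_I z, hz1, harg]; simp
  rw [hz, ← map_one (InfinitePlace.Completion.extensionEmbedding σ)] at this
  exact (InfinitePlace.Completion.extensionEmbedding σ).injective this

namespace LogData

variable {𝔪 : Modulus F} (D : LogData F 𝔪)

theorem logS_eq_of_sub_mem {z : sIdeles D.S} {b : Fin D.r → ℤ}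
    (hb : D.logM (D.residue z) = .ofAdd ↑b) {y : D.Coord}
    (hy : D.rawLog z + (0, b, 0, 0) - y ∈ D.baseLattice) :
    D.logS z = .ofAdd ↑y := by
  change Multiplicative.ofAdd ((D.rawLog z : D.Coord ⧸ D.baseLattice) +
    D.embedM (D.logM (D.residue z)).toAdd) = _
  rw [hb]
  congr 1
  change ((D.rawLog z + (0, b, 0, 0) : D.Coord) : D.Coord ⧸ D.baseLattice) = _
  rw [QuotientAddGroup.eq, ← neg_mem_iff]
  convert! hy using 1
  abel

theorem logIdele_eq_logS {x : Ideles F} (hx : x ∈ sIdeles D.S) :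
    D.logIdele x = .ofAdd (D.proj (D.logS ⟨x, hx⟩).toAdd) := by
  have h : x * (diag F 1)⁻¹ ∈ sIdeles D.S := by simpa using hx
  rw [D.logIdele_apply x 1 h]
  congr 4
  simp

theorem logIdele_eq_of_sub_mem {x : Ideles F} (hx : x ∈ sIdeles D.S) {b : Fin D.r → ℤ}
    (hb : D.logM (D.residue x) = .ofAdd ↑b) {y : D.Coord}
    (hy : D.rawLog x + (0, b, 0, 0) - y ∈ D.baseLattice) :
    D.logIdele x = .ofAdd ↑y := by
  rw [D.logIdele_eq_logS hx, D.logS_eq_of_sub_mem (z := ⟨x, hx⟩) hb hy]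
  rfl

theorem exists_logM_eq (x : Ideles F) : ∃ b : Fin D.r → ℤ, D.logM (D.residue x) = .ofAdd ↑b := by
  obtain ⟨b, hb⟩ := QuotientAddGroup.mk_surjective (D.logM (D.residue x)).toAdd
  exact ⟨b, congrArg Multiplicative.ofAdd hb.symm⟩

theorem rawLog_add_mem_of_logS_eq {z : sIdeles D.S} {b : Fin D.r → ℤ}
    (hb : D.logM (D.residue z) = .ofAdd ↑b) {y : D.Coord} (h : D.logS z = .ofAdd ↑y) :
    D.rawLog z + (0, b, 0, 0) - y ∈ D.baseLattice := by
  have h' : D.logS z = .ofAdd ((D.rawLog z + (0, b, 0, 0) : D.Coord) : D.Coord ⧸ D.baseLattice) :=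
    D.logS_eq_of_sub_mem hb (by simp [zero_mem])
  rw [h] at h'
  have := (QuotientAddGroup.eq.1 (Multiplicative.ofAdd.injective h'))
  convert! this using 1
  abel

/-- The kernel of `ℒ_S` is contained in `U(𝔪)`. -/
theorem mem_congrOne_of_logS_eq_one {z : sIdeles D.S} (h : D.logS z = 1) :
    (z : Ideles F) ∈ 𝔪.congrOne := by
  obtain ⟨b, hb⟩ := D.exists_logM_eq z
  obtain ⟨h1, h2, h3, h4⟩ := D.rawLog_add_mem_of_logS_eq hb (y := 0) h
  have hval : ∀ p, val p (z : Ideles F) = 0 := by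
    intro p
    by_cases hp : p ∈ D.S
    · have := congrFun h1 ⟨p, hp⟩
      simpa [rawLog] using this
    · simp [val, z.2 p hp]
  have hv : ∀ p, Valued.v (finComp p (z : Ideles F)) = 1 := by
    intro p
    have h0 := (Valuation.ne_zero_iff Valued.v).2 (finComp_ne_zero p (z : Ideles F))
    have := hval p
    rw [val, neg_eq_zero] at this
    rw [← WithZero.exp_log h0, this, WithZero.exp_zero]
  have hres : D.residue z = 1 := by
    have : b ∈ D.latticeM := by simpa [rawLog] using h2
    have h0 : ((b : Fin D.r → ℤ) : (Fin D.r → ℤ) ⧸ D.latticeM) = 0 :=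
      (QuotientAddGroup.eq_zero_iff b).2 this
    rw [h0, ofAdd_zero] at hb
    exact D.logM.map_eq_one_iff.1 hb
  have hnorm : ∀ σ, ‖infComp σ (z : Ideles F)‖ = 1 := by
    intro σ
    have h0 := norm_pos_iff.2 (infComp_ne_zero σ (z : Ideles F))
    have := congrFun h3 σ
    have hm : (σ.mult : ℝ) ≠ 0 := by exact_mod_cast InfinitePlace.mult_ne_zero
    have hlog : Real.log ‖infComp σ (z : Ideles F)‖ = 0 := by
      simpa [rawLog, hm, Real.pi_ne_zero] using! this
    exact Real.eq_one_of_pos_of_log_eq_zero h0 hlog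
  refine ⟨fun p ↦ ⟨hv p, ?_⟩, fun σ hσ ↦ ?_, fun σ hσ _ ↦ ?_, fun σ hσ ↦ ?_⟩
  · have h5 : 𝔪.quotEquiv.symm (Ideal.Quotient.mk _ (D.unitPart z : LocalIntegers F)) = 1 :=
      congrArg Units.val (congrArg Prod.fst hres)
    rw [RingEquiv.map_eq_one_iff, ← map_one (Ideal.Quotient.mk 𝔪.localIdeal),
      Ideal.Quotient.eq] at h5
    have h6 : Valued.v (finComp p (z : Ideles F) * D.unif p ^ (-val p (z : Ideles F)) - 1) ≤ _ :=
      h5 p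
    simpa [hval] using h6
  · have hr := 𝔪.inf_isReal σ hσ
    have h5 : SignType.sign (InfinitePlace.Completion.extensionEmbeddingOfIsReal hr
        (infComp σ (z : Ideles F))) = 1 :=
      congrArg Units.val (congrFun (congrArg Prod.snd hres) ⟨σ, hσ⟩)
    have h6 : ‖InfinitePlace.Completion.extensionEmbeddingOfIsReal hr
        (infComp σ (z : Ideles F))‖ = 1 := by
      rw [← hnorm σ]
      exact (InfinitePlace.Completion.isometry_extensionEmbeddingOfIsReal hr).norm_map_of_map_zero
        (map_zero _) _
    rw [sign_eq_one_iff] at h5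
    rw [Real.norm_of_nonneg h5.le] at h6
    exact (InfinitePlace.Completion.extensionEmbeddingOfIsReal hr).injective
      (h6.trans (map_one _).symm)
  · have h6 : ‖InfinitePlace.Completion.extensionEmbeddingOfIsReal hσ
        (infComp σ (z : Ideles F))‖ = 1 := by
      rw [← hnorm σ]
      exact (InfinitePlace.Completion.isometry_extensionEmbeddingOfIsReal hσ).norm_map_of_map_zero
        (map_zero _) _
    rw [Real.norm_eq_abs, abs_eq zero_le_one] at h6
    refine h6.imp (fun h ↦ ?_) fun h ↦ ?_ <;>
    refine (InfinitePlace.Completion.extensionEmbeddingOfIsReal hσ).injective (h.trans ?_) <;> simp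
  · obtain ⟨k, hk⟩ := h4 ⟨σ, hσ⟩ trivial
    refine infComp_eq_one_of_arg (hnorm σ) (k := k) ?_
    simpa [rawLog] using! hk

/-- The logarithm is injective on the idèle class group. -/
theorem mem_kernel_of_logIdele_eq_one {x : Ideles F} (h : D.logIdele x = 1) : x ∈ 𝔪.kernel := by
  obtain ⟨α, hα⟩ := D.exists_sIdele x
  obtain ⟨y, hy⟩ := QuotientAddGroup.mk_surjective (D.logS ⟨_, hα⟩).toAdd
  rw [D.logIdele_apply x α hα, ofAdd_eq_one, ← hy] at h
  have hmem : y ∈ D.lattice := (QuotientAddGroup.eq_zero_iff y).1 h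
  obtain ⟨z, ⟨β, hβ⟩, hz⟩ := hmem
  have hz' : D.logS (⟨_, hα⟩ * z⁻¹) = 1 := by
    rw [map_mul, map_inv, mul_inv_eq_one]
    exact (congrArg Multiplicative.ofAdd hy).symm.trans hz.symm
  have h1 := D.mem_congrOne_of_logS_eq_one hz'
  have h2 : x = diag F (α * β) * (x * (diag F α)⁻¹ * (z : Ideles F)⁻¹) := by
    have hβ' : diag F β = z := hβ
    rw [← hβ', map_mul]
    generalize diag F α = a
    generalize diag F β = c
    have : a * c * (x * a⁻¹ * c⁻¹) = x * (a * a⁻¹) * (c * c⁻¹) := by ac_rfl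
    rw [this]; simp
  rw [h2]
  exact mul_mem (Subgroup.mem_sup_left ⟨_, rfl⟩) (Subgroup.mem_sup_right h1)

end LogData

end Hecke

/-! ### Idèles with prescribed finite components -/

namespace Hecke

variable {F : Type*} [Field F] [NumberField F]

theorem exists_idele (f : ∀ p : HeightOneSpectrum (𝓞 F), p.adicCompletion F)
    (hf : ∀ p, f p ≠ 0) (hf' : ∀ᶠ p in Filter.cofinite, Valued.v (f p) = 1)
    (g : ∀ σ : InfinitePlace F, σ.Completion) (hg : ∀ σ, g σ ≠ 0) :
    ∃ x : Ideles F, (∀ p, finComp p x = f p) ∧ ∀ σ, infComp σ x = g σ := by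
  have hint : ∀ᶠ p in Filter.cofinite, f p ∈ p.adicCompletionIntegers F :=
    hf'.mono fun p hp ↦ hp.le
  let a : FiniteAdeleRing (𝓞 F) F := ⟨f, hint⟩
  obtain ⟨u, hu⟩ := FiniteAdeleRing.isUnit_iff (a := a).2 ⟨hf, hf'⟩
  let v : (InfiniteAdeleRing F)ˣ := ⟨g, fun σ ↦ (g σ)⁻¹,
    funext fun σ ↦ mul_inv_cancel₀ (hg σ), funext fun σ ↦ inv_mul_cancel₀ (hg σ)⟩
  refine ⟨MulEquiv.prodUnits.symm (v, u), fun p ↦ ?_, fun σ ↦ rfl⟩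
  change (u : FiniteAdeleRing (𝓞 F) F) p = f p
  rw [hu]
  rfl

/-- Every residue class modulo `𝔪_f` is the reduction of an element of `∏_𝔭 ℤ_𝔭ˣ`. -/
theorem Modulus.exists_reduce_eq (𝔪 : Modulus F) (ρ : (𝓞 F ⧸ 𝔪.fin)ˣ) :
    ∃ u : (LocalIntegers F)ˣ, 𝔪.reduce u = ρ := by
  classical
  obtain ⟨t, ht⟩ := Ideal.Quotient.mk_surjective (𝔪.quotEquiv ρ)
  obtain ⟨t', ht'⟩ := Ideal.Quotient.mk_surjective (𝔪.quotEquiv (ρ⁻¹ : (𝓞 F ⧸ 𝔪.fin)ˣ))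
  have htt : t * t' - 1 ∈ 𝔪.localIdeal := by
    rw [← Ideal.Quotient.eq, map_mul, ht, ht', ← map_mul, Units.mul_inv, map_one, map_one]
  -- At a prime dividing `𝔪_f` the component of `t` is a unit; elsewhere it is replaced by `1`.
  have hunit : ∀ p, ¬ 𝔪.exponent p = 0 → IsUnit (t p) := by
    intro p hp
    have h1 : Valued.v ((t p : p.adicCompletion F) * t' p - 1) < 1 := by
      refine lt_of_le_of_lt (htt p) ?_
      rw [← WithZero.exp_zero, WithZero.exp_lt_exp]
      omega
    rw [adicCompletionIntegers.isUnit_iff_valued_eq_one]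
    have h2 : Valued.v ((t p : p.adicCompletion F) * t' p) = 1 := by
      have h3 := Valuation.map_one_add_of_lt (v := Valued.v) h1
      rwa [add_sub_cancel] at h3
    rw [map_mul] at h2
    refine le_antisymm (t p).2 ?_
    calc (1 : ℤᵐ⁰) = _ := h2.symm
      _ ≤ Valued.v (t p : p.adicCompletion F) * 1 := mul_le_mul' le_rfl (t' p).2
      _ = _ := mul_one _
  have hu : ∀ p, IsUnit (if 𝔪.exponent p = 0 then 1 else t p) := by
    intro p
    split_ifs with h
    · exact isUnit_one
    · exact hunit p h
  choose u hu using hu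
  refine ⟨MulEquiv.piUnits.symm u, Units.ext ?_⟩
  change 𝔪.quotEquiv.symm (Ideal.Quotient.mk _ (fun p ↦ (u p : p.adicCompletionIntegers F))) = _
  rw [RingEquiv.symm_apply_eq, ← ht, Ideal.Quotient.eq]
  intro p
  change Valued.v (((u p : p.adicCompletionIntegers F) - t p :
    p.adicCompletionIntegers F) : p.adicCompletion F) ≤ _
  rw [hu]
  split_ifs with h
  · rw [h]
    exact (1 - t p).2
  · simp

namespace LogData

variable {𝔪 : Modulus F} (D : LogData F 𝔪)

/-- The logarithm hits every element of `ℤ^ℓ`. -/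
theorem exists_logIdele_eq_int (a : D.S → ℤ) (b : Fin D.r → ℤ) :
    ∃ x : Ideles F, D.logIdele x = .ofAdd ↑((a, b, 0, 0) : D.Coord) := by
  classical
  obtain ⟨⟨ρ, ε⟩, hρ⟩ := D.logM.surjective (.ofAdd (b : (Fin D.r → ℤ) ⧸ D.latticeM))
  obtain ⟨u, hu⟩ := 𝔪.exists_reduce_eq ρ
  let n : HeightOneSpectrum (𝓞 F) → ℤ := fun p ↦ if h : p ∈ D.S then a ⟨p, h⟩ else 0
  let u' := MulEquiv.piUnits u
  have hvu : ∀ p, Valued.v ((u' p : p.adicCompletionIntegers F) : p.adicCompletion F) = 1 :=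
    fun p ↦ adicCompletionIntegers.isUnit_iff_valued_eq_one.1 (u' p).isUnit
  have hvx : ∀ p, Valued.v (((u' p : p.adicCompletionIntegers F) : p.adicCompletion F) *
      D.unif p ^ n p) = WithZero.exp (-n p) := by
    intro p
    rw [map_mul, hvu, one_mul, map_zpow₀, D.valued_unif, ← WithZero.exp_zsmul]
    simp
  have hS : ∀ p, p ∉ D.S → n p = 0 := fun p hp ↦ dif_neg hp
  have hε : ∀ e : SignTypeˣ, ((e : SignType) : ℤ) = 1 ∨ ((e : SignType) : ℤ) = -1 := by
    intro e
    have := e.ne_zero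
    revert this
    generalize (e : SignType) = s
    cases s <;> simp
  obtain ⟨x, hx, hx'⟩ := exists_idele
    (fun p ↦ ((u' p : p.adicCompletionIntegers F) : p.adicCompletion F) * D.unif p ^ n p)
    (fun p h ↦ by
      have := hvx p
      rw [h, map_zero] at this
      exact WithZero.exp_ne_zero this.symm)
    (by
      refine Set.Finite.subset D.S.finite_toSet fun p hp ↦ ?_
      by_contra h
      exact hp (by change Valued.v _ = 1; rw [hvx, hS p h]; simp))
    (fun σ ↦ if h : σ ∈ 𝔪.inf then (((ε ⟨σ, h⟩ : SignType) : ℤ) : σ.Completion) else 1)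
    (fun σ ↦ by
      split_ifs with h
      · rcases hε (ε ⟨σ, h⟩) with h1 | h1 <;> simp [h1]
      · exact one_ne_zero)
  have hval : ∀ p, val p x = n p := fun p ↦ by
    rw [val, hx, hvx]; simp
  have hxS : x ∈ sIdeles D.S := fun p hp ↦ by rw [hx, hvx, hS p hp]; simp
  have hres : D.residue x = (ρ, ε) := by
    refine Prod.ext ?_ (funext fun σ ↦ Units.ext ?_)
    · change 𝔪.reduce (D.unitPart x) = ρ
      rw [← hu]
      congr 1
      refine Units.ext (funext fun p ↦ Subtype.ext ?_)
      change finComp p x * D.unif p ^ (-val p x) = _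
      rw [hx, hval, mul_assoc, ← zpow_add₀ (D.unif_ne_zero p)]
      simp [u']
    · change SignType.sign (InfinitePlace.Completion.extensionEmbeddingOfIsReal
        (𝔪.inf_isReal σ.1 σ.2) (infComp σ.1 x)) = ε σ
      rw [hx', dif_pos σ.2, map_intCast]
      generalize (ε σ : SignType) = s
      cases s <;> simp
  refine ⟨x, D.logIdele_eq_of_sub_mem hxS (hres ▸ hρ) ?_⟩
  have hnorm : ∀ σ, ‖infComp σ x‖ = 1 := by
    intro σ
    rw [hx']
    split_ifs with h
    · rcases hε (ε ⟨σ, h⟩) with h1 | h1 <;> simp [h1]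
    · exact norm_one
  have : D.rawLog x + (0, b, 0, 0) - (a, b, 0, 0) = 0 := by
    refine Prod.ext ?_ (Prod.ext ?_ (Prod.ext ?_ ?_))
    · funext p
      simp [rawLog, hval, n]
    · simp [rawLog]
    · funext σ
      simp [rawLog, hnorm]
    · funext σ
      have : σ.1 ∉ 𝔪.inf := fun h ↦
        InfinitePlace.not_isReal_iff_isComplex.2 σ.2 (𝔪.inf_isReal _ h)
      simp [rawLog, hx', this]
  rw [this]
  exact zero_mem _

end LogData

end Hecke

/-! ### A continuous section of the logarithm -/

namespace Hecke

section Archimedean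

variable {F : Type*} [Field F]

open InfinitePlace.Completion in
open scoped Classical in
/-- The element of the completion at `σ` with modulus coordinate `v.1 σ` and, if `σ` is
complex, argument coordinate `v.2 σ`. The modulus coordinate is `n_σ/(2π) log |x_σ|`. -/
def archComponent (σ : InfinitePlace F)
    (v : (InfinitePlace F → ℝ) × ({σ : InfinitePlace F // σ.IsComplex} → ℝ)) : σ.Completion :=
  if h : σ.IsReal then (ringEquivRealOfIsReal h).symm (Real.exp (2 * Real.pi * v.1 σ))
  else (ringEquivComplexOfIsComplex (InfinitePlace.not_isReal_iff_isComplex.1 h)).symm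
    (Complex.exp (Real.pi * v.1 σ +
      2 * Real.pi * v.2 ⟨σ, InfinitePlace.not_isReal_iff_isComplex.1 h⟩ * Complex.I))

theorem archComponent_add (σ : InfinitePlace F)
    (v w : (InfinitePlace F → ℝ) × ({σ : InfinitePlace F // σ.IsComplex} → ℝ)) :
    archComponent σ (v + w) = archComponent σ v * archComponent σ w := by
  unfold archComponent
  split_ifs with h
  · rw [← map_mul, ← Real.exp_add]
    simp [mul_add]
  · rw [← map_mul, ← Complex.exp_add]
    congr 2
    simp
    ring

theorem archComponent_zero (σ : InfinitePlace F) : archComponent σ 0 = 1 := by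
  unfold archComponent
  split_ifs with h <;> simp

theorem continuous_archComponent (σ : InfinitePlace F) : Continuous (archComponent σ) := by
  unfold archComponent
  split_ifs with h
  · exact (InfinitePlace.Completion.isometryEquivRealOfIsReal h).symm.continuous.comp
      (by fun_prop)
  · exact (InfinitePlace.Completion.isometryEquivComplexOfIsComplex
      (InfinitePlace.not_isReal_iff_isComplex.1 h)).symm.continuous.comp (by fun_prop)

theorem norm_archComponent (σ : InfinitePlace F)
    (v : (InfinitePlace F → ℝ) × ({σ : InfinitePlace F // σ.IsComplex} → ℝ)) :
    ‖archComponent σ v‖ = Real.exp (2 * Real.pi * v.1 σ / σ.mult) := by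
  unfold archComponent
  split_ifs with h
  · have hi := (InfinitePlace.Completion.isometryEquivRealOfIsReal h).symm.isometry
    have := hi.norm_map_of_map_zero
      (map_zero (InfinitePlace.Completion.ringEquivRealOfIsReal h).symm)
        (Real.exp (2 * Real.pi * v.1 σ))
    refine this.trans ?_
    rw [InfinitePlace.mult, if_pos h]
    simp
  · have hc := InfinitePlace.not_isReal_iff_isComplex.1 h
    have hi := (InfinitePlace.Completion.isometryEquivComplexOfIsComplex hc).symm.isometry
    have := hi.norm_map_of_map_zero
      (map_zero (InfinitePlace.Completion.ringEquivComplexOfIsComplex hc).symm)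
        (Complex.exp (Real.pi * v.1 σ + 2 * Real.pi * v.2 ⟨σ, hc⟩ * Complex.I))
    refine this.trans ?_
    rw [InfinitePlace.mult, if_neg h, Complex.norm_exp]
    congr 1
    simp
    ring

end Archimedean

variable {F : Type*} [Field F] [NumberField F]

variable (F) in
/-- The idèle with trivial finite components and prescribed archimedean coordinates. -/
def archIdele : Multiplicative ((InfinitePlace F → ℝ) ×
    ({σ : InfinitePlace F // σ.IsComplex} → ℝ)) →* Ideles F :=
  MonoidHom.toHomUnits
    { toFun := fun v ↦ ((fun σ ↦ archComponent σ v.toAdd, 1) :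
        InfiniteAdeleRing F × FiniteAdeleRing (𝓞 F) F)
      map_one' := Prod.ext (funext fun σ ↦ archComponent_zero σ) rfl
      map_mul' := fun _ _ ↦ Prod.ext (funext fun σ ↦ archComponent_add σ _ _) (one_mul 1).symm }

theorem infComp_archIdele (σ : InfinitePlace F)
    (v : (InfinitePlace F → ℝ) × ({σ : InfinitePlace F // σ.IsComplex} → ℝ)) :
    infComp σ (archIdele F (.ofAdd v)) = archComponent σ v := rfl

theorem finComp_archIdele (p : HeightOneSpectrum (𝓞 F))
    (v : (InfinitePlace F → ℝ) × ({σ : InfinitePlace F // σ.IsComplex} → ℝ)) :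
    finComp p (archIdele F (.ofAdd v)) = 1 := rfl

theorem continuous_archIdele : Continuous (archIdele F) := by
  have h : Continuous fun v : Multiplicative ((InfinitePlace F → ℝ) ×
      ({σ : InfinitePlace F // σ.IsComplex} → ℝ)) ↦
        ((archIdele F v : Ideles F) : AdeleRing (𝓞 F) F) := by
    refine Continuous.prodMk (X := InfiniteAdeleRing F) (Y := FiniteAdeleRing (𝓞 F) F)
      (continuous_pi fun σ ↦ ?_) continuous_const
    exact (continuous_archComponent σ).comp continuous_toAdd
  refine Units.continuous_iff.2 ⟨h, ?_⟩
  simp_rw [← map_inv]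
  exact h.comp continuous_inv

theorem ideleNorm_archIdele (v : (InfinitePlace F → ℝ) ×
    ({σ : InfinitePlace F // σ.IsComplex} → ℝ)) :
    ideleNorm (archIdele F (.ofAdd v)) = Real.exp (2 * Real.pi * ∑ σ, v.1 σ) := by
  change (∏ σ, ‖infComp σ _‖ ^ σ.mult) * ∏ᶠ p, ‖finComp p _‖ = _
  simp only [infComp_archIdele, finComp_archIdele, norm_archComponent, norm_one, finprod_one,
    mul_one, ← Real.exp_nat_mul, ← Real.exp_sum, Finset.mul_sum]
  congr 1
  refine Finset.sum_congr rfl fun σ _ ↦ ?_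
  have hm : (σ.mult : ℝ) ≠ 0 := by exact_mod_cast InfinitePlace.mult_ne_zero
  field_simp

namespace LogData

variable {𝔪 : Modulus F} (D : LogData F 𝔪)

theorem logIdele_archIdele (c : InfinitePlace F → ℝ)
    (d : {σ : InfinitePlace F // σ.IsComplex} → ℝ) :
    D.logIdele (archIdele F (.ofAdd (c, d))) = .ofAdd ↑((0, 0, c, d) : D.Coord) := by
  have hval : ∀ p, val p (archIdele F (.ofAdd (c, d))) = 0 := fun p ↦ by
    simp [val, finComp_archIdele]
  have hS : archIdele F (.ofAdd (c, d)) ∈ sIdeles D.S := fun p _ ↦ by simp [finComp_archIdele]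
  have hres : D.residue (archIdele F (.ofAdd (c, d))) = 1 := by
    refine Prod.ext ?_ (funext fun σ ↦ Units.ext ?_)
    · change 𝔪.reduce (D.unitPart _) = 1
      convert! map_one 𝔪.reduce
      refine Units.ext (funext fun p ↦ Subtype.ext ?_)
      change finComp p _ * D.unif p ^ (-val p _) = 1
      simp [hval, finComp_archIdele]
    · change SignType.sign (InfinitePlace.Completion.extensionEmbeddingOfIsReal
        (𝔪.inf_isReal σ.1 σ.2) (infComp σ.1 _)) = 1
      rw [infComp_archIdele, archComponent, dif_pos (𝔪.inf_isReal σ.1 σ.2)]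
      rw [← InfinitePlace.Completion.ringEquivRealOfIsReal_apply, RingEquiv.apply_symm_apply,
        sign_eq_one_iff]
      positivity
  refine D.logIdele_eq_of_sub_mem hS (b := 0) (by rw [hres, map_one]; rfl) ?_
  refine ⟨?_, ?_, ?_, ?_⟩
  · change _ = (0 : D.S → ℤ)
    funext p
    simp [rawLog, hval]
  · simp [rawLog, zero_mem]
  · change _ = (0 : InfinitePlace F → ℝ)
    funext σ
    have hm : (σ.mult : ℝ) ≠ 0 := by exact_mod_cast InfinitePlace.mult_ne_zero
    have := Real.pi_ne_zero
    simp [rawLog, infComp_archIdele, norm_archComponent]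
  · intro σ _
    have hσ : ¬ σ.1.IsReal := InfinitePlace.not_isReal_iff_isComplex.2 σ.2
    have hx : InfinitePlace.Completion.extensionEmbedding σ.1
        (infComp σ.1 (archIdele F (.ofAdd (c, d)))) =
        Complex.exp (Real.pi * c σ.1 + 2 * Real.pi * d σ * Complex.I) := by
      rw [infComp_archIdele, archComponent, dif_neg hσ,
        ← InfinitePlace.Completion.ringEquivComplexOfIsComplex_apply σ.2,
        RingEquiv.apply_symm_apply]
    have harg : ((Complex.arg (Complex.exp (Real.pi * c σ.1 + 2 * Real.pi * d σ * Complex.I)) : ℝ) :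
        Real.Angle) = ((2 * Real.pi * d σ : ℝ) : Real.Angle) := by
      rw [Complex.arg_exp]
      simp
    rw [Real.Angle.angle_eq_iff_two_pi_dvd_sub] at harg
    obtain ⟨k, hk⟩ := harg
    refine ⟨k, ?_⟩
    rw [← hx] at hk
    simp only [rawLog]
    have := Real.pi_pos
    simp
    field_simp
    linarith

/-- A section of the logarithm, which on the real coordinates is given by `archIdele`. -/
theorem exists_section : ∃ s : Multiplicative D.Coord →* Ideles F, Continuous s ∧
    (∀ y : D.Coord, D.logIdele (s (.ofAdd y)) = .ofAdd ↑y) ∧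
    ∀ c d, s (.ofAdd (0, 0, c, d)) = archIdele F (.ofAdd (c, d)) := by
  classical
  choose z hz using fun p : D.S ↦ D.exists_logIdele_eq_int (Pi.single p 1) 0
  choose w hw using fun i : Fin D.r ↦ D.exists_logIdele_eq_int 0 (Pi.single i 1)
  let s : Multiplicative D.Coord →* Ideles F :=
    { toFun := fun y ↦ (∏ p, z p ^ y.toAdd.1 p) * (∏ i, w i ^ y.toAdd.2.1 i) *
        archIdele F (.ofAdd y.toAdd.2.2)
      map_one' := by simp
      map_mul' := fun x y ↦ by
        simp only [toAdd_mul, Prod.fst_add, Prod.snd_add, Pi.add_apply, zpow_add,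
          Finset.prod_mul_distrib, ofAdd_add, map_mul]
        ac_rfl }
  refine ⟨s, ?_, fun y ↦ ?_, fun c d ↦ ?_⟩
  · refine Continuous.mul (Continuous.mul ?_ ?_) ?_
    · exact (continuous_of_discreteTopology (f := fun a : D.S → ℤ ↦ ∏ p, z p ^ a p)).comp
        (continuous_fst.comp continuous_toAdd)
    · exact (continuous_of_discreteTopology (f := fun a : Fin D.r → ℤ ↦ ∏ p, w p ^ a p)).comp
        (continuous_fst.comp (continuous_snd.comp continuous_toAdd))
    · exact continuous_archIdele.comp (continuous_ofAdd.comp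
        (continuous_snd.comp (continuous_snd.comp continuous_toAdd)))
  · have hy : y = (∑ p, y.1 p • ((Pi.single p 1, 0, 0, 0) : D.Coord)) +
        (∑ i, y.2.1 i • ((0, Pi.single i 1, 0, 0) : D.Coord)) + (0, 0, y.2.2.1, y.2.2.2) := by
      refine Prod.ext ?_ (Prod.ext ?_ (Prod.ext ?_ ?_)) <;>
        simp [Prod.fst_sum, Prod.snd_sum, funext_iff, Pi.single_apply]
    change D.logIdele ((∏ p, z p ^ y.1 p) * (∏ i, w i ^ y.2.1 i) *
        archIdele F (.ofAdd y.2.2)) = _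
    rw [map_mul, map_mul, map_prod, map_prod, D.logIdele_archIdele]
    simp only [map_zpow, hz, hw]
    conv_rhs => rw [hy]
    rw [QuotientAddGroup.mk_add, QuotientAddGroup.mk_add, ofAdd_add, ofAdd_add]
    congr 2
    · change _ = Multiplicative.ofAdd (QuotientAddGroup.mk' D.lattice _)
      rw [map_sum, ofAdd_sum]
      rfl
    · change _ = Multiplicative.ofAdd (QuotientAddGroup.mk' D.lattice _)
      rw [map_sum, ofAdd_sum]
      rfl
  · simp [s]

end LogData

end Hecke

/-! ### Continuity of the logarithm at the identity -/

namespace Hecke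

open Filter Topology

variable {F : Type*} [Field F] [NumberField F]

theorem continuous_infComp (σ : InfinitePlace F) : Continuous (infComp (F := F) σ) :=
  (continuous_apply σ).comp (continuous_fst.comp Units.continuous_val)

theorem continuous_finAdele : Continuous fun x : Ideles F ↦ (x : AdeleRing (𝓞 F) F).2 :=
  continuous_snd.comp Units.continuous_val

theorem continuous_finComp (p : HeightOneSpectrum (𝓞 F)) : Continuous (finComp (F := F) p) :=
  (RestrictedProduct.continuous_eval p).comp continuous_finAdele

theorem eventually_valued_finComp_le_one :
    ∀ᶠ x : Ideles F in 𝓝 1, ∀ p, Valued.v (finComp p x) ≤ 1 := by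
  have hopen : IsOpen {a : FiniteAdeleRing (𝓞 F) F |
      ∀ p, a.1 p ∈ (p.adicCompletionIntegers F : Set (p.adicCompletion F))} :=
    RestrictedProduct.isOpen_forall_mem fun p ↦ Valued.isOpen_valuationSubring _
  exact continuous_finAdele.continuousAt.eventually_mem (hopen.mem_nhds fun p ↦ one_mem _)

theorem eventually_valued_finComp_eq_one :
    ∀ᶠ x : Ideles F in 𝓝 1, ∀ p, Valued.v (finComp p x) = 1 := by
  have hinv : Tendsto (fun x : Ideles F ↦ x⁻¹) (𝓝 1) (𝓝 1) := by
    simpa using (continuous_inv (G := Ideles F)).tendsto 1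
  filter_upwards [eventually_valued_finComp_le_one,
    hinv.eventually eventually_valued_finComp_le_one] with x h1 h2 p
  refine le_antisymm (h1 p) ?_
  calc (1 : ℤᵐ⁰) = Valued.v (finComp p x) * Valued.v (finComp p x⁻¹) := by
        rw [← map_mul, ← map_mul, mul_inv_cancel, map_one, map_one]
    _ ≤ Valued.v (finComp p x) * 1 := mul_le_mul' le_rfl (h2 p)
    _ = _ := mul_one _

theorem valued_ball_mem_nhds (p : HeightOneSpectrum (𝓞 F)) (n : ℕ) :
    {z : p.adicCompletion F | Valued.v (z - 1) ≤ WithZero.exp (-(n : ℤ))} ∈ 𝓝 1 := by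
  obtain ⟨π, hπ⟩ := valuedAdicCompletion_surjective F p (WithZero.exp (-(n : ℤ)))
  have hπ0 : Valued.v.restrict π ≠ 0 := by
    rw [Valuation.ne_zero_iff]
    rintro rfl
    rw [map_zero] at hπ
    exact WithZero.exp_ne_zero hπ.symm
  refine Valued.mem_nhds.2 ⟨Units.mk0 _ hπ0, fun y hy ↦ ?_⟩
  rw [Set.mem_ofPred_eq, ← hπ]
  exact ((Valuation.restrict_lt_iff _).1 hy).le

theorem Modulus.eventually_congr_one (𝔪 : Modulus F) :
    ∀ᶠ x : Ideles F in 𝓝 1, ∀ p, Valued.v (finComp p x) = 1 ∧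
      Valued.v (finComp p x - 1) ≤ WithZero.exp (-(𝔪.exponent p : ℤ)) := by
  have hfin : {p : HeightOneSpectrum (𝓞 F) | p.asIdeal ∣ 𝔪.fin}.Finite :=
    Ideal.finite_factors 𝔪.fin_ne_bot
  have h : ∀ᶠ x : Ideles F in 𝓝 1, ∀ p ∈ {p : HeightOneSpectrum (𝓞 F) | p.asIdeal ∣ 𝔪.fin},
      Valued.v (finComp p x - 1) ≤ WithZero.exp (-(𝔪.exponent p : ℤ)) := by
    refine (eventually_all_finite hfin).2 fun p _ ↦ ?_
    have := (continuous_finComp p).tendsto (1 : Ideles F)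
    rw [map_one] at this
    exact this (valued_ball_mem_nhds p _)
  filter_upwards [h, eventually_valued_finComp_eq_one] with x h1 h2 p
  refine ⟨h2 p, ?_⟩
  by_cases hp : p.asIdeal ∣ 𝔪.fin
  · exact h1 p hp
  · rw [Modulus.exponent, multiplicity_eq_zero.2 hp]
    exact (Valuation.map_sub _ _ _).trans (max_le (h2 p).le (map_one _).le)

namespace LogData

variable {𝔪 : Modulus F} (D : LogData F 𝔪)

/-- Near `1` the finite components and the signs do not contribute to the logarithm. -/
theorem eventually_logIdele_eq :
    ∀ᶠ x : Ideles F in 𝓝 1, D.logIdele x = .ofAdd ↑((0, 0, (D.rawLog x).2.2) : D.Coord) := by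
  have hsign : ∀ᶠ x : Ideles F in 𝓝 1, ∀ σ : 𝔪.inf,
      0 < InfinitePlace.Completion.extensionEmbeddingOfIsReal (𝔪.inf_isReal σ.1 σ.2)
        (infComp σ.1 x) := by
    refine eventually_all.2 fun σ ↦ ?_
    have hc := (InfinitePlace.Completion.isometry_extensionEmbeddingOfIsReal
      (𝔪.inf_isReal σ.1 σ.2)).continuous.comp (continuous_infComp σ.1)
    refine hc.continuousAt.eventually_mem (Ioi_mem_nhds ?_)
    simp
  filter_upwards [𝔪.eventually_congr_one, hsign] with x h1 h2
  have hval : ∀ p, val p x = 0 := fun p ↦ by simp [val, (h1 p).1]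
  have hres : D.residue x = 1 := by
    refine Prod.ext ?_ (funext fun σ ↦ Units.ext (sign_eq_one_iff.2 (h2 σ)))
    change 𝔪.reduce (D.unitPart x) = 1
    apply Units.ext
    change 𝔪.quotEquiv.symm (Ideal.Quotient.mk _ (D.unitPart x : LocalIntegers F)) = 1
    rw [RingEquiv.map_eq_one_iff, ← map_one (Ideal.Quotient.mk 𝔪.localIdeal), Ideal.Quotient.eq]
    intro p
    change Valued.v (finComp p x * D.unif p ^ (-val p x) - 1) ≤ _
    rw [hval]
    simpa using (h1 p).2
  refine D.logIdele_eq_of_sub_mem (fun p _ ↦ (h1 p).1) (b := 0) (by rw [hres, map_one]; rfl) ?_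
  have : D.rawLog x + (0, 0, 0, 0) - (0, 0, (D.rawLog x).2.2) = 0 := by
    refine Prod.ext (funext fun p ↦ ?_) (Prod.ext ?_ ?_)
    · simp [rawLog, hval]
    · simp [rawLog]
    · simp
  rw [this]
  exact zero_mem _

theorem continuousAt_rawLog : ContinuousAt (fun x : Ideles F ↦ (D.rawLog x).2.2) 1 := by
  refine ContinuousAt.prodMk (continuousAt_pi.2 fun σ ↦ ?_) (continuousAt_pi.2 fun σ ↦ ?_)
  · refine continuousAt_const.mul (ContinuousAt.log (continuous_infComp σ).norm.continuousAt ?_)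
    simp
  · refine ContinuousAt.div_const ?_ _
    have hc := (InfinitePlace.Completion.isometry_extensionEmbedding σ.1).continuous.comp
      (continuous_infComp σ.1)
    refine ContinuousAt.comp (g := Complex.arg) (Complex.continuousAt_arg ?_) hc.continuousAt
    simp [Complex.one_mem_slitPlane]

/-- A character of `ℤ^ℓ × ℝ^n` given by an element of the dual lattice descends to
`(ℤ^ℓ × ℝ^n)/Λ`. -/
def latticeCharacter (w : D.dualLattice) : Multiplicative (D.Coord ⧸ D.lattice) →* Circle :=
  AddMonoidHom.toMultiplicativeLeft <|
    QuotientAddGroup.lift D.lattice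
      (AddMonoidHom.mk' (fun y ↦ Additive.ofMul
        (Circle.exp (2 * Real.pi * inner ℝ (w : D.Hyperplane) (D.p₀ (D.toSpace y)))))
        fun x y ↦ by
          rw [← ofMul_mul, ← Circle.exp_add, map_add, map_add, inner_add_right, mul_add]) <| by
    intro y hy
    obtain ⟨k, hk⟩ := Submodule.mem_one.1 (w.2 (D.p₀ (D.toSpace y)) ⟨y, hy, rfl⟩)
    have hk' : inner ℝ (w : D.Hyperplane) (D.p₀ (D.toSpace y)) = k := hk.symm
    change Additive.ofMul _ = 0
    rw [ofMul_eq_zero, hk', mul_comm]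
    exact Circle.exp_int_mul_two_pi k

theorem latticeCharacter_apply (w : D.dualLattice) (y : D.Coord) :
    D.latticeCharacter w (.ofAdd ↑y) =
      Circle.exp (2 * Real.pi * inner ℝ (w : D.Hyperplane) (D.p₀ (D.toSpace y))) := rfl

theorem continuous_latticeCharacter_log (w : D.dualLattice) :
    Continuous fun x ↦ D.latticeCharacter w (D.log x) := by
  refine (QuotientGroup.isQuotientMap_mk 𝔪.kernel).continuous_iff.2 ?_
  change Continuous ((D.latticeCharacter w).comp D.logIdele)
  refine continuous_of_continuousAt_one _ ?_
  have h : ContinuousAt (fun x : Ideles F ↦ Circle.exp (2 * Real.pi *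
      inner ℝ (w : D.Hyperplane) (D.p₀ (D.toSpace (0, 0, (D.rawLog x).2.2))))) 1 := by
    have hc : Continuous fun v ↦ Circle.exp (2 * Real.pi *
        inner ℝ (w : D.Hyperplane) (D.p₀ (D.toSpace (0, 0, v)))) := by
      have := D.continuous_toSpace.comp
        (g := D.toSpace) (f := fun v ↦ ((0, 0, v) : D.Coord)) (by fun_prop)
      exact Circle.exp.continuous.comp
        (continuous_const.mul (continuous_const.inner (D.p₀.continuous.comp this)))
    exact ContinuousAt.comp (g := fun v ↦ Circle.exp (2 * Real.pi *
        inner ℝ (w : D.Hyperplane) (D.p₀ (D.toSpace (0, 0, v))))) hc.continuousAt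
        D.continuousAt_rawLog
  refine h.congr (D.eventually_logIdele_eq.mono fun x hx ↦ ?_)
  rw [MonoidHom.comp_apply, hx, latticeCharacter_apply]

end LogData

end Hecke

/-! ### The projected lattice spans the hyperplane -/

namespace Hecke

variable {F : Type*} [Field F] [NumberField F]

theorem norm_infComp_diag (σ : InfinitePlace F) (α : Fˣ) : ‖infComp σ (diag F α)‖ = σ (α : F) :=
  InfinitePlace.Completion.norm_coe σ _

theorem valued_finComp_diag (p : HeightOneSpectrum (𝓞 F)) (α : Fˣ) :
    Valued.v (finComp p (diag F α)) = p.valuation F α :=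
  valuedAdicCompletion_eq_valuation' p _

theorem val_diag (p : HeightOneSpectrum (𝓞 F)) (α : Fˣ) :
    val p (diag F α) = -WithZero.log (p.valuation F α) := by
  rw [val, valued_finComp_diag]

theorem valuation_unit (p : HeightOneSpectrum (𝓞 F)) (ε : (𝓞 F)ˣ) :
    p.valuation F (ε : F) = 1 := by
  rw [valuation_of_algebraMap, intValuation_eq_one_iff]
  exact fun h ↦ p.isPrime.ne_top (Ideal.eq_top_of_isUnit_mem _ h ε.isUnit)

/-- Some power of a prime is principal, hence there is an element of `F` whose valuation is
nontrivial exactly at that prime. -/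
theorem exists_valuation_ne_one_only_at (p : HeightOneSpectrum (𝓞 F)) :
    ∃ γ : Fˣ, WithZero.log (p.valuation F γ) ≠ 0 ∧ ∀ q, q ≠ p → q.valuation F γ = 1 := by
  have h1 := pow_card_eq_one
    (x := ClassGroup.mk0 ⟨p.asIdeal, mem_nonZeroDivisors_of_ne_zero p.ne_bot⟩)
  rw [← map_pow, ClassGroup.mk0_eq_one_iff] at h1
  obtain ⟨g, hg⟩ := h1
  have hg' : p.asIdeal ^ Fintype.card (ClassGroup (𝓞 F)) = Ideal.span {g} := hg
  have hg0 : g ≠ 0 := by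
    rintro rfl
    have : p.asIdeal ^ Fintype.card (ClassGroup (𝓞 F)) = 0 := by rw [hg']; simp
    exact pow_ne_zero _ p.ne_bot this
  have hmem : g ∈ p.asIdeal ^ Fintype.card (ClassGroup (𝓞 F)) := by
    rw [hg']; exact Ideal.mem_span_singleton_self g
  refine ⟨Units.mk0 (g : F) (by simpa using hg0), ?_, fun q hq ↦ ?_⟩
  · rw [Units.val_mk0, valuation_of_algebraMap]
    have hlt : p.intValuation g < 1 :=
      (intValuation_lt_one_iff_mem p g).2 (Ideal.pow_le_self Fintype.card_ne_zero hmem)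
    have := (WithZero.log_lt_log (p.intValuation_ne_zero g hg0) one_ne_zero).2 hlt
    rw [WithZero.log_one] at this
    exact this.ne
  · rw [Units.val_mk0, valuation_of_algebraMap, intValuation_eq_one_iff]
    intro h
    have hle : p.asIdeal ^ Fintype.card (ClassGroup (𝓞 F)) ≤ q.asIdeal := by
      rw [hg', Ideal.span_singleton_le_iff_mem]; exact h
    have := (p.isMaximal.eq_of_le q.isPrime.ne_top (q.isPrime.le_of_pow_le hle)).symm
    exact hq (HeightOneSpectrum.ext this)

namespace LogData

variable {𝔪 : Modulus F} (D : LogData F 𝔪)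

theorem mem_lattice_iff {y : D.Coord} : y ∈ D.lattice ↔
    ∃ (β : Fˣ) (b : Fin D.r → ℤ), diag F β ∈ sIdeles D.S ∧
      D.logM (D.residue (diag F β)) = .ofAdd ↑b ∧
        D.rawLog (diag F β) + (0, b, 0, 0) - y ∈ D.baseLattice := by
  constructor
  · rintro ⟨z, ⟨β, hβ⟩, hz⟩
    obtain ⟨b, hb⟩ := D.exists_logM_eq z
    have hβ' : diag F β = z := hβ
    refine ⟨β, b, hβ' ▸ z.2, hβ' ▸ hb, ?_⟩
    rw [hβ']
    exact D.rawLog_add_mem_of_logS_eq hb hz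
  · rintro ⟨β, b, hS, hb, h⟩
    exact ⟨⟨_, hS⟩, ⟨β, rfl⟩, D.logS_eq_of_sub_mem (z := ⟨_, hS⟩) hb h⟩

/-- The logarithm of an `S`-unit, completed by a representative of its residue class, is in `Λ`. -/
theorem exists_mem_lattice (β : Fˣ) (hS : diag F β ∈ sIdeles D.S) :
    ∃ b : Fin D.r → ℤ, D.rawLog (diag F β) + (0, b, 0, 0) ∈ D.lattice := by
  obtain ⟨b, hb⟩ := D.exists_logM_eq (diag F β)
  exact ⟨b, D.mem_lattice_iff.2 ⟨β, b, hS, hb, by simp [zero_mem]⟩⟩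

open scoped Classical in
theorem inner_normVector (w : D.Space) :
    inner ℝ w D.normVector = ∑ σ, w (.inr (.inr (.inl σ))) * (σ.mult : ℝ) := by
  rw [normVector, inner_toSpace]
  simp

theorem inner_p₀ (w : D.Hyperplane) (y : D.Space) :
    inner ℝ w (D.p₀ y) = inner ℝ (w : D.Space) y :=
  D.Hyperplane.inner_orthogonalProjectionOnto_eq_of_mem_left w y

theorem inner_normVector_eq_zero (w : D.Hyperplane) : inner ℝ (w : D.Space) D.normVector = 0 := by
  rw [real_inner_comm]
  exact Submodule.mem_orthogonal_singleton_iff_inner_right.1 w.2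

open scoped Classical in
/-- By Dirichlet's unit theorem, a vector orthogonal to the weighted logarithms of all units is
constant, hence zero if its weighted sum vanishes. -/
theorem eq_zero_of_orthogonal_units (c : InfinitePlace F → ℝ)
    (hc : ∀ ε : (𝓞 F)ˣ, ∑ σ, c σ * ((σ.mult : ℝ) * Real.log (σ (ε : F))) = 0)
    (hsum : ∑ σ, c σ * (σ.mult : ℝ) = 0) : c = 0 := by
  let f : Units.dirichletUnitTheorem.logSpace F →ₗ[ℝ] ℝ :=
    ∑ σ, (c σ.1 - c Units.dirichletUnitTheorem.w₀) • LinearMap.proj σ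
  have hf : ∀ v, f v = ∑ σ, (c σ.1 - c Units.dirichletUnitTheorem.w₀) * v σ := fun v ↦ by
    simp [f]
  have hker : Submodule.span ℝ (Units.unitLattice F : Set (Units.dirichletUnitTheorem.logSpace F))
      ≤ LinearMap.ker f := by
    rw [Submodule.span_le]
    rintro _ ⟨ε, -, rfl⟩
    have h1 := hc ε.toMul
    have h2 := Units.sum_mult_mul_log ε.toMul
    rw [Fintype.sum_eq_add_sum_subtype_ne _ Units.dirichletUnitTheorem.w₀] at h1 h2
    rw [SetLike.mem_coe, LinearMap.mem_ker, hf]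
    simp only [sub_mul, Finset.sum_sub_distrib, ← Finset.mul_sum]
    change ∑ σ : {σ : InfinitePlace F // σ ≠ Units.dirichletUnitTheorem.w₀},
        c σ.1 * (σ.1.mult * Real.log (σ.1 (ε.toMul : F))) -
      c _ * ∑ σ : {σ : InfinitePlace F // σ ≠ Units.dirichletUnitTheorem.w₀},
        σ.1.mult * Real.log (σ.1 (ε.toMul : F)) = 0
    linear_combination h1 - c Units.dirichletUnitTheorem.w₀ * h2
  rw [Units.dirichletUnitTheorem.unitLattice_span_eq_top, top_le_iff, LinearMap.ker_eq_top] at hker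
  have heq : ∀ σ, c σ = c Units.dirichletUnitTheorem.w₀ := by
    intro σ
    by_cases h : σ = Units.dirichletUnitTheorem.w₀
    · rw [h]
    · have := hf (Pi.single ⟨σ, h⟩ 1)
      rw [hker] at this
      simp [Pi.single_apply] at this
      linarith
  have hpos : 0 < ∑ σ : InfinitePlace F, (σ.mult : ℝ) :=
    Finset.sum_pos (fun σ _ ↦ by exact_mod_cast InfinitePlace.mult_pos)
      ⟨Units.dirichletUnitTheorem.w₀, Finset.mem_univ _⟩
  have h0 : c Units.dirichletUnitTheorem.w₀ = 0 := by
    simp only [heq, ← Finset.mul_sum] at hsum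
    exact (mul_eq_zero.1 hsum).resolve_right hpos.ne'
  funext σ
  rw [heq, h0]; rfl

open scoped Classical in
theorem inner_rawLog_add {w : D.Space} (hM : ∀ i, w (.inr (.inl i)) = 0)
    (hC : ∀ σ, w (.inr (.inr (.inr σ))) = 0) (x : Ideles F) (b : Fin D.r → ℤ) :
    inner ℝ w (D.toSpace (D.rawLog x + (0, b, 0, 0))) = (∑ p, w (.inl p) * val p.1 x) +
      (∑ σ, w (.inr (.inr (.inl σ))) * ((σ.mult : ℝ) * Real.log ‖infComp σ x‖)) /
        (2 * Real.pi) := by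
  have h1 : ∀ p, (D.rawLog x + (0, b, 0, 0)).1 p = val p.1 x := fun p ↦ by simp [rawLog]
  have h2 : ∀ σ, (D.rawLog x + (0, b, 0, 0)).2.2.1 σ =
      (σ.mult : ℝ) / (2 * Real.pi) * Real.log ‖infComp σ x‖ := fun σ ↦ by simp [rawLog]
  rw [inner_toSpace]
  simp only [h1, h2, hM, hC, zero_mul, Finset.sum_const_zero, zero_add, add_zero, Finset.sum_div]
  congr 1
  refine Finset.sum_congr rfl fun σ _ ↦ ?_
  ring

/-- The lattice `Λ`, together with `v₀`, spans `ℝ^{ℓ+n}`, in dual form. -/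
theorem eq_zero_of_orthogonal_lattice (w : D.Hyperplane)
    (hw : ∀ y ∈ D.lattice, inner ℝ (w : D.Space) (D.toSpace y) = 0) : w = 0 := by
  classical
  have hbase : ∀ y ∈ D.baseLattice, inner ℝ (w : D.Space) (D.toSpace y) = 0 :=
    fun y hy ↦ hw y (D.baseLattice_le hy)
  have hM : ∀ i, (w : D.Space) (.inr (.inl i)) = 0 := by
    intro i
    have : Finite ((Fin D.r → ℤ) ⧸ D.latticeM) := by
      have : Finite (𝓞 F ⧸ 𝔪.fin) := Ideal.finiteQuotientOfFreeOfNeBot _ 𝔪.fin_ne_bot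
      exact Finite.of_equiv _ D.logM.toEquiv
    -- `Λ_𝔪` contains a multiple of every basis vector, as `(ℤ_F/𝔪)ˣ` is finite.
    have hN : (Nat.card ((Fin D.r → ℤ) ⧸ D.latticeM) : ℕ) • (Pi.single i 1 : Fin D.r → ℤ) ∈
        D.latticeM := by
      rw [← QuotientAddGroup.eq_zero_iff, QuotientAddGroup.mk_nsmul]
      exact card_nsmul_eq_zero'
    have := hbase (0, (Nat.card ((Fin D.r → ℤ) ⧸ D.latticeM) : ℕ) • Pi.single i 1, 0, 0)
      ⟨rfl, hN, rfl, fun _ _ ↦ ⟨0, by simp⟩⟩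
    rw [inner_toSpace] at this
    simpa [Pi.single_apply, Nat.card_pos.ne'] using this
  have hC : ∀ σ, (w : D.Space) (.inr (.inr (.inr σ))) = 0 := by
    intro σ
    have := hbase (0, 0, 0, Pi.single σ 1) ⟨rfl, zero_mem _, rfl, fun τ _ ↦ by
      by_cases h : τ = σ
      · subst h; exact ⟨1, by simp⟩
      · exact ⟨0, by simp [h]⟩⟩
    rw [inner_toSpace] at this
    simpa [Pi.single_apply] using this
  have hR : (fun σ ↦ (w : D.Space) (.inr (.inr (.inl σ)))) = 0 := by
    refine eq_zero_of_orthogonal_units _ (fun ε ↦ ?_) ?_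
    · obtain ⟨β, hβ⟩ : ∃ β : Fˣ, (β : F) = ε := ⟨Units.mk0 (ε : F) (by simp), rfl⟩
      have hv : ∀ p : HeightOneSpectrum (𝓞 F), p.valuation F (β : F) = 1 :=
        fun p ↦ hβ ▸ valuation_unit p ε
      have hS : diag F β ∈ sIdeles D.S := fun p _ ↦ (valued_finComp_diag p β).trans (hv p)
      obtain ⟨b, hb⟩ := D.exists_mem_lattice β hS
      have := hw _ hb
      rw [D.inner_rawLog_add hM hC] at this
      have hval : ∀ p, val p (diag F β) = 0 := fun p ↦ by simp [val_diag, hv]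
      simp only [hval, Int.cast_zero, mul_zero, Finset.sum_const_zero, zero_add,
        norm_infComp_diag, hβ] at this
      exact (div_eq_zero_iff.1 this).resolve_right (by positivity)
    · rw [← inner_normVector, inner_normVector_eq_zero]
  have hS : ∀ p, (w : D.Space) (.inl p) = 0 := by
    intro p
    obtain ⟨γ, hγ, hγ'⟩ := exists_valuation_ne_one_only_at p.1
    obtain ⟨b, hb⟩ := D.exists_mem_lattice γ fun q hq ↦ by
      rw [valued_finComp_diag]
      exact hγ' q fun h ↦ hq (h ▸ p.2)
    have := hw _ hb
    have hR' : ∀ σ, (w : D.Space) (.inr (.inr (.inl σ))) = 0 := fun σ ↦ congrFun hR σ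
    rw [D.inner_rawLog_add hM hC] at this
    simp only [hR', zero_mul, Finset.sum_const_zero, zero_div, add_zero, val_diag] at this
    rw [Finset.sum_eq_single p] at this
    · simpa [hγ] using this
    · intro q _ hq
      rw [hγ' q.1 fun h ↦ hq (Subtype.ext h)]
      simp
    · simp
  refine Subtype.ext (PiLp.ext fun i ↦ ?_)
  rcases i with i | i | i | i
  · exact hS i
  · exact hM i
  · exact congrFun hR i
  · exact hC i

theorem span_projLattice : Submodule.span ℝ (D.projLattice : Set D.Hyperplane) = ⊤ := by
  rw [← Submodule.orthogonal_eq_bot_iff, eq_bot_iff]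
  intro w hw
  refine D.eq_zero_of_orthogonal_lattice w fun y hy ↦ ?_
  rw [← inner_p₀, real_inner_comm]
  exact hw _ (Submodule.subset_span ⟨y, hy, rfl⟩)

end LogData

end Hecke

/-! ### The projected lattice is discrete -/

namespace Hecke

variable {F : Type*} [Field F] [NumberField F]

/-- The product formula for an element of `F` that is a unit at all primes. -/
theorem sum_mult_mul_log_eq_zero {β : Fˣ}
    (hβ : ∀ p : HeightOneSpectrum (𝓞 F), p.valuation F (β : F) = 1) :
    ∑ σ : InfinitePlace F, (σ.mult : ℝ) * Real.log (σ (β : F)) = 0 := by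
  have h := ideleNorm_diag β
  change (∏ σ : InfinitePlace F, ‖infComp σ (diag F β)‖ ^ σ.mult) *
    (∏ᶠ p : HeightOneSpectrum (𝓞 F), ‖finComp p (diag F β)‖) = 1 at h
  rw [finprod_eq_one_of_forall_eq_one fun p ↦
    (norm_eq_one_iff p _).2 ((valued_finComp_diag p β).trans (hβ p)), mul_one] at h
  have hlog := congrArg Real.log h
  rw [Real.log_prod fun σ _ ↦ pow_ne_zero _ (norm_ne_zero_iff.2 (infComp_ne_zero σ _)),
    Real.log_one] at hlog
  simpa only [Real.log_pow, norm_infComp_diag] using hlog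

/-- Only finitely many elements of `F` are units at all primes and bounded at all archimedean
places. -/
theorem finite_units_bounded (B : ℝ) :
    {β : Fˣ | (∀ p : HeightOneSpectrum (𝓞 F), p.valuation F (β : F) = 1) ∧
      ∀ σ : InfinitePlace F, σ (β : F) ≤ B}.Finite := by
  refine Set.Finite.of_finite_image ((Embeddings.finite_of_norm_le F ℂ B).subset ?_)
    (Units.val_injective.injOn)
  rintro _ ⟨β, ⟨h1, h2⟩, rfl⟩
  obtain ⟨a, ha⟩ := mem_integers_of_valuation_le_one F (β : F) fun p ↦ (h1 p).le
  refine ⟨ha ▸ a.2, fun φ ↦ ?_⟩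
  rw [← InfinitePlace.apply]
  exact h2 _

/-- If logarithms `L i` with weights `m i` sum to zero, and agree up to a bounded error with a
multiple of the weights, then they are bounded: the multiple is controlled by the sum. -/
theorem le_of_sum_eq_zero_of_close {ι : Type*} [Fintype ι] {m L v : ι → ℝ} {t : ℝ}
    (hm : ∀ i, 1 ≤ m i) (hv : ∀ i, |v i| ≤ 1 / 2)
    (h : ∀ i, m i / (2 * Real.pi) * L i = v i + t * m i) (hL : ∑ i, m i * L i = 0) (i : ι) :
    L i ≤ 2 * Real.pi * (1 / 2 + Fintype.card ι) := by
  set N : ℝ := ((Fintype.card ι : ℕ) : ℝ) with hN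
  have hN0 : 0 ≤ N := Nat.cast_nonneg _
  have hπ := Real.pi_pos
  have hsum : ∑ j, v j + t * ∑ j, m j = 0 := by
    rw [Finset.mul_sum, ← Finset.sum_add_distrib]
    simp_rw [← h, div_mul_eq_mul_div]
    rw [← Finset.sum_div, hL, zero_div]
  have hn : 1 ≤ ∑ j, m j := (hm i).trans
    (Finset.single_le_sum (f := m) (fun j _ ↦ zero_le_one.trans (hm j)) (Finset.mem_univ i))
  have ht : |t| ≤ N / 2 := by
    have h3 : |∑ j, v j| ≤ N / 2 := by
      refine (Finset.abs_sum_le_sum_abs _ _).trans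
        ((Finset.sum_le_card_nsmul _ _ (1 / 2) fun j _ ↦ hv j).trans ?_)
      simp [N, div_eq_mul_inv]
    have h4 : t * ∑ j, m j = -∑ j, v j := by linarith
    have h5 := congrArg abs h4
    rw [abs_neg, abs_mul, abs_of_nonneg (zero_le_one.trans hn)] at h5
    nlinarith [abs_nonneg t]
  have hmi : 0 < m i := zero_lt_one.trans_le (hm i)
  have h6 : L i = 2 * Real.pi * (v i / m i + t) := by
    have := h i
    field_simp at this ⊢
    linarith
  have h8 : v i / m i ≤ 1 / 2 := by
    rw [div_le_iff₀ hmi]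
    linarith [(abs_le.1 (hv i)).2, hm i]
  rw [h6]
  exact mul_le_mul_of_nonneg_left (by linarith [(abs_le.1 ht).2]) (by positivity)

namespace LogData

variable {𝔪 : Modulus F} (D : LogData F 𝔪)

theorem exists_eq_p₀_add_smul (y : D.Space) :
    ∃ t : ℝ, y = (D.p₀ y : D.Space) + t • D.normVector := by
  have h := Submodule.sub_starProjection_mem_orthogonal (K := D.Hyperplane) y
  rw [Submodule.orthogonal_orthogonal, Submodule.mem_span_singleton] at h
  obtain ⟨t, ht⟩ := h
  refine ⟨t, ?_⟩
  rw [ht]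
  change y = D.Hyperplane.starProjection y + _
  abel

theorem abs_apply_le (v : D.Hyperplane) (i : D.Index) : |(v : D.Space) i| ≤ ‖v‖ :=
  PiLp.norm_apply_le (v : D.Space) i

/-- An element of `Λ` whose integral coordinates vanish comes from an element of `F` that is a unit
at all primes; its arguments are determined up to integers. -/
theorem exists_unit_of_mem_lattice {y : D.Coord} (hy : y ∈ D.lattice) (h1 : y.1 = 0)
    (h2 : y.2.1 = 0) :
    ∃ (β : Fˣ) (k : {σ : InfinitePlace F // σ.IsComplex} → ℤ),
      (∀ p : HeightOneSpectrum (𝓞 F), p.valuation F (β : F) = 1) ∧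
      y = (0, 0, (D.rawLog (diag F β)).2.2.1, fun σ ↦ (D.rawLog (diag F β)).2.2.2 σ - k σ) := by
  obtain ⟨β, b, hS, -, e1, -, e3, e4⟩ := D.mem_lattice_iff.1 hy
  choose k hk using fun σ ↦ e4 σ trivial
  refine ⟨β, k, fun p ↦ ?_, ?_⟩
  · rw [← valued_finComp_diag]
    by_cases hp : p ∈ D.S
    · have := congrFun e1 ⟨p, hp⟩
      have h0 := (Valuation.ne_zero_iff Valued.v).2 (finComp_ne_zero p (diag F β))
      have hlog : WithZero.log (Valued.v (finComp p (diag F β))) = 0 := by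
        simpa [rawLog, h1, val] using this
      rw [← WithZero.exp_log h0, hlog, WithZero.exp_zero]
    · exact hS p hp
  · refine Prod.ext h1 (Prod.ext h2 (Prod.ext (funext fun σ ↦ ?_) (funext fun σ ↦ ?_)))
    · have := congrFun e3 σ
      simp only [Prod.snd_sub, Prod.fst_sub, Prod.snd_add, Prod.fst_add, Pi.sub_apply, Pi.add_apply,
        Pi.zero_apply] at this
      linarith
    · have := hk σ
      simp only [Int.coe_castAddHom, Prod.snd_sub, Prod.snd_add, Pi.sub_apply, Pi.add_apply,
        Pi.zero_apply] at this
      linarith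

/-- A ball of radius `1/2` forces the integral coordinates to vanish, so it meets `p₀(Λ)` only in
projections of logarithms of units; their absolute values are bounded, and so are the integers by
which the arguments are shifted. -/
theorem finite_projLattice_inter_ball :
    ((D.projLattice : Set D.Hyperplane) ∩ Metric.closedBall 0 (1 / 2)).Finite := by
  classical
  let G : Fˣ × ({σ : InfinitePlace F // σ.IsComplex} → ℤ) → D.Hyperplane := fun x ↦
    D.p₀ (D.toSpace (0, 0, (D.rawLog (diag F x.1)).2.2.1,
      fun σ ↦ (D.rawLog (diag F x.1)).2.2.2 σ - x.2 σ))
  refine (((finite_units_bounded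
    (Real.exp (2 * Real.pi * (1 / 2 + Fintype.card (InfinitePlace F))))).prod
    (Set.finite_Icc (fun _ ↦ -1) (fun _ ↦ 1))).image G).subset ?_
  rintro _ ⟨⟨y, hy, rfl⟩, hball⟩
  change D.p₀ (D.toSpace y) ∈ _ at hball
  change D.p₀ (D.toSpace y) ∈ _
  rw [mem_closedBall_zero_iff] at hball
  set v := D.p₀ (D.toSpace y) with hv
  obtain ⟨t, ht⟩ := D.exists_eq_p₀_add_smul (D.toSpace y)
  rw [← hv] at ht
  have hcoord : ∀ i, |(v : D.Space) i| ≤ 1 / 2 := fun i ↦ (D.abs_apply_le v i).trans hball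
  have happly : ∀ i, D.toSpace y i = (v : D.Space) i + t * D.normVector i := fun i ↦ by
    conv_lhs => rw [ht]
    simp
  have hzero : ∀ {m : ℤ} {x : ℝ}, |x| ≤ 1 / 2 → (m : ℝ) = x → m = 0 := by
    rintro m x hx rfl
    rw [← Int.cast_abs] at hx
    have h : ((|m| : ℤ) : ℝ) < 1 := by linarith
    have h' : |m| < 1 := by exact_mod_cast h
    exact Int.abs_lt_one_iff.1 h'
  have h1 : y.1 = 0 := funext fun p ↦ hzero (hcoord (.inl p)) <| by
    simpa [toSpace, normVector] using happly (.inl p)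
  have h2 : y.2.1 = 0 := funext fun i ↦ hzero (hcoord (.inr (.inl i))) <| by
    simpa [toSpace, normVector] using happly (.inr (.inl i))
  obtain ⟨β, k, hβ, hyβ⟩ := D.exists_unit_of_mem_lattice hy h1 h2
  refine ⟨(β, k), ⟨⟨hβ, fun σ ↦ ?_⟩, ?_⟩, by rw [hv, hyβ]⟩
  · have hc : ∀ σ : InfinitePlace F, (σ.mult : ℝ) / (2 * Real.pi) * Real.log (σ (β : F)) =
        (v : D.Space) (.inr (.inr (.inl σ))) + t * σ.mult := by
      intro σ
      have := happly (.inr (.inr (.inl σ)))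
      rw [hyβ] at this
      simpa [toSpace, normVector, rawLog, norm_infComp_diag] using this
    have hlog := le_of_sum_eq_zero_of_close (m := fun σ : InfinitePlace F ↦ (σ.mult : ℝ))
      (fun σ ↦ by exact_mod_cast InfinitePlace.one_le_mult) (fun σ ↦ hcoord _) hc
      (sum_mult_mul_log_eq_zero hβ) σ
    exact (Real.log_le_iff_le_exp (InfinitePlace.pos_iff.2 β.ne_zero)).1 hlog
  · have hk : ∀ σ, |(k σ : ℝ)| ≤ 1 := by
      intro σ
      have h3 := happly (.inr (.inr (.inr σ)))
      rw [hyβ] at h3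
      have h4 := hcoord (.inr (.inr (.inr σ)))
      have h5 : Complex.arg (InfinitePlace.Completion.extensionEmbedding σ.1
          (infComp σ.1 (diag F β))) / (2 * Real.pi) - k σ =
            (v : D.Space) (.inr (.inr (.inr σ))) := by
        simpa [toSpace, normVector, rawLog] using h3
      have h6 : |Complex.arg (InfinitePlace.Completion.extensionEmbedding σ.1
          (infComp σ.1 (diag F β))) / (2 * Real.pi)| ≤ 1 / 2 := by
        have hπ := Real.pi_pos
        rw [abs_div, abs_of_pos (by positivity : (0 : ℝ) < 2 * Real.pi),
          div_le_iff₀ (by positivity)]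
        linarith [Complex.abs_arg_le_pi (InfinitePlace.Completion.extensionEmbedding σ.1
          (infComp σ.1 (diag F β)))]
      rw [abs_le] at h4 h6 ⊢
      constructor <;> linarith
    refine ⟨fun σ ↦ ?_, fun σ ↦ ?_⟩
    · exact_mod_cast (abs_le.1 (hk σ)).1
    · exact_mod_cast (abs_le.1 (hk σ)).2

theorem discreteTopology_projLattice : DiscreteTopology D.projLattice := by
  refine discreteTopology_of_isOpen_singleton_zero ?_
  refine isOpen_singleton_of_finite_mem_nhds 0 (s := Metric.closedBall 0 (1 / 2))
    (Metric.closedBall_mem_nhds _ (by norm_num)) ?_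
  refine Set.Finite.of_finite_image (D.finite_projLattice_inter_ball.subset ?_)
    Subtype.val_injective.injOn
  rintro _ ⟨v, hv, rfl⟩
  exact ⟨v.2, by simpa using hv⟩

/-- The dual lattice is spanned over `ℤ` by a basis of the hyperplane: the basis dual to a basis
of `p₀(Λ)`. -/
theorem exists_basis_dualLattice : ∃ (n : ℕ) (b : Basis (Fin n) ℝ D.Hyperplane),
    D.dualLattice = Submodule.span ℤ (Set.range b) := by
  classical
  have := D.discreteTopology_projLattice
  have : IsZLattice ℝ D.projLattice := ⟨D.span_projLattice⟩
  have := ZLattice.module_free ℝ D.projLattice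
  have := ZLattice.module_finite ℝ D.projLattice
  let b := (finBasis ℤ D.projLattice).ofZLatticeBasis ℝ D.projLattice
  have hB : LinearMap.BilinForm.Nondegenerate (innerₗ D.Hyperplane) :=
    ⟨fun v h ↦ inner_self_eq_zero.1 (h v), fun v h ↦ inner_self_eq_zero.1 (h v)⟩
  refine ⟨_, LinearMap.BilinForm.dualBasis _ hB b, ?_⟩
  rw [dualLattice, ← LinearMap.BilinForm.dualSubmodule_span_of_basis]
  congr 1
  exact (Basis.ofZLatticeBasis_span ..).symm

end LogData

end Hecke

/-! ### The norm-one class group is compact -/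

namespace Hecke

variable {F : Type*} [Field F] [NumberField F]

theorem exp_two_pi_mul_eq_one_iff {r : ℝ} :
    Circle.exp (2 * Real.pi * r) = 1 ↔ ∃ k : ℤ, r = k := by
  rw [Circle.exp_eq_one]
  have := Real.pi_ne_zero
  refine exists_congr fun k ↦ ⟨fun h ↦ ?_, fun h ↦ ?_⟩
  · field_simp at h
    linarith
  · rw [h]; ring

theorem eq_zero_of_forall_mul_int {r : ℝ} (h : ∀ t : ℝ, ∃ k : ℤ, t * r = k) : r = 0 := by
  by_contra hr
  -- The scalar is chosen so that the product is `1/2`.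
  obtain ⟨k, hk⟩ := h (1 / (2 * r))
  have h1 : (2 * k : ℝ) = 1 := by rw [← hk]; field_simp
  have h2 : 2 * k = 1 := by exact_mod_cast h1
  omega

theorem ideleNorm_pos (x : Ideles F) : 0 < ideleNorm x := by
  refine lt_of_le_of_ne ?_ ((Group.isUnit x).map ideleNorm).ne_zero.symm
  exact mul_nonneg (Finset.prod_nonneg fun σ _ ↦ pow_nonneg (norm_nonneg _) _)
    (finprod_nonneg fun p ↦ norm_nonneg _)

namespace LogData

variable {𝔪 : Modulus F} (D : LogData F 𝔪)

/-- The vector `v₀` scaled by `t`, in `ℤ^ℓ × ℝ^n`. -/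
def normCoord (t : ℝ) : D.Coord := (0, 0, fun σ ↦ t * σ.mult, 0)

theorem toSpace_normCoord (t : ℝ) : D.toSpace (D.normCoord t) = t • D.normVector := by
  ext (i | i | i | i) <;> simp [normCoord, normVector, toSpace]

theorem p₀_normVector : D.p₀ D.normVector = 0 := by
  refine ext_inner_left ℝ fun w ↦ ?_
  rw [inner_p₀, inner_normVector_eq_zero, inner_zero_right]

theorem p₀_toSpace_sub_normCoord (y : D.Coord) (t : ℝ) :
    D.p₀ (D.toSpace (y - D.normCoord t)) = D.p₀ (D.toSpace y) := by
  rw [map_sub, map_sub, toSpace_normCoord, map_smul, p₀_normVector, smul_zero, sub_zero]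

theorem exists_log_eq (x : 𝔪.IdeleClassGroup) : ∃ y : D.Coord, D.log x = .ofAdd ↑y := by
  obtain ⟨y, hy⟩ := QuotientAddGroup.mk_surjective (D.log x).toAdd
  exact ⟨y, congrArg Multiplicative.ofAdd hy.symm⟩

theorem log_injective : Function.Injective D.log := by
  refine (injective_iff_map_eq_one _).2 fun x hx ↦ ?_
  obtain ⟨z, rfl⟩ := QuotientGroup.mk_surjective x
  exact (QuotientGroup.eq_one_iff z).2 (D.mem_kernel_of_logIdele_eq_one hx)

/-- A continuous homomorphism `ℤ^ℓ × ℝ^n → C_𝔪¹` that is trivial on `ℝ v₀` and inverts the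
logarithm: it is obtained from a section of the logarithm by correcting the norm along `v₀`. -/
theorem exists_section_normOne : ∃ S : Multiplicative D.Coord →* 𝔪.normOne, Continuous S ∧
    (∀ y : D.Coord, ∃ t : ℝ, D.log (S (.ofAdd y)) = .ofAdd ↑(y - D.normCoord t)) ∧
    (∀ t, S (.ofAdd (D.normCoord t)) = 1) ∧
    ∀ (x : 𝔪.normOne) (y : D.Coord), D.log x = .ofAdd ↑y → S (.ofAdd y) = x := by
  classical
  obtain ⟨s, hs, hlog, harch⟩ := D.exists_section
  -- `M` is the logarithm of the norm, in the coordinates of `ℤ^ℓ × ℝ^n`.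
  let M : D.Coord →+ ℝ := AddMonoidHom.mk' (fun y ↦ Real.log (ideleNorm (s (.ofAdd y))))
    fun x y ↦ by
      rw [ofAdd_add, map_mul, map_mul, Real.log_mul (ideleNorm_pos _).ne' (ideleNorm_pos _).ne']
  have hM : ∀ c d, M (0, 0, c, d) = 2 * Real.pi * ∑ σ, c σ := fun c d ↦ by
    change Real.log (ideleNorm (s (.ofAdd _))) = _
    rw [harch, ideleNorm_archIdele, Real.log_exp]
  -- `M` is given by a linear form on the real coordinates, and the other ones are discrete.
  have hMcont : Continuous M := by
    have hMeq : ∀ y, M y = M (y.1, y.2.1, 0, 0) + 2 * Real.pi * ∑ σ, y.2.2.1 σ := fun y ↦ by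
      rw [← hM y.2.2.1 y.2.2.2, ← map_add]
      congr 1
      ext <;> simp
    rw [show ⇑M = _ from funext hMeq]
    refine Continuous.add ?_ (by fun_prop)
    exact (continuous_of_discreteTopology
      (f := fun z : (D.S → ℤ) × (Fin D.r → ℤ) ↦ M (z.1, z.2, 0, 0))).comp
        (g := fun z : (D.S → ℤ) × (Fin D.r → ℤ) ↦ M (z.1, z.2, 0, 0))
        (f := fun y : D.Coord ↦ (y.1, y.2.1)) (by fun_prop)
  set n : ℝ := ∑ σ : InfinitePlace F, (σ.mult : ℝ) with hn
  have hn0 : 0 < n := Finset.sum_pos (fun σ _ ↦ by exact_mod_cast InfinitePlace.mult_pos)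
    ⟨Units.dirichletUnitTheorem.w₀, Finset.mem_univ _⟩
  have hMn : ∀ t, M (D.normCoord t) = 2 * Real.pi * n * t := fun t ↦ by
    rw [normCoord, hM, ← Finset.mul_sum, ← hn]; ring
  have hπ := Real.pi_pos
  -- Subtracting `T y • v₀` from `y` brings it into the kernel of `M`.
  let T : D.Coord → ℝ := fun y ↦ M y / (2 * Real.pi * n)
  have hT : ∀ y, M (y - D.normCoord (T y)) = 0 := fun y ↦ by
    rw [map_sub, hMn]
    simp only [T]
    field_simp
    ring
  have hmem : ∀ y : D.Coord, (QuotientGroup.mk (s (.ofAdd (y - D.normCoord (T y)))) :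
      𝔪.IdeleClassGroup) ∈ 𝔪.normOne := fun y ↦ by
    change ideleNorm (s (.ofAdd _)) = 1
    exact Real.eq_one_of_pos_of_log_eq_zero (ideleNorm_pos _) (hT y)
  have hTadd : ∀ x y, D.normCoord (T (x + y)) = D.normCoord (T x) + D.normCoord (T y) := by
    intro x y
    simp only [normCoord, T, map_add]
    ext <;> simp
    ring
  let S : Multiplicative D.Coord →* 𝔪.normOne := MonoidHom.mk' (fun y ↦ ⟨_, hmem y.toAdd⟩) <| by
    intro x y
    refine Subtype.ext ?_
    change (QuotientGroup.mk _ : 𝔪.IdeleClassGroup) = QuotientGroup.mk _ * QuotientGroup.mk _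
    rw [← QuotientGroup.mk_mul, ← map_mul, ← ofAdd_add, toAdd_mul, hTadd]
    congr 3
    abel
  have hnc : Continuous D.normCoord := by
    unfold normCoord
    fun_prop
  refine ⟨S, ?_, fun y ↦ ⟨T y, ?_⟩, fun t ↦ Subtype.ext ?_, fun x y hxy ↦ Subtype.ext ?_⟩
  · refine Continuous.subtype_mk (continuous_quot_mk.comp (hs.comp (continuous_ofAdd.comp ?_))) _
    have hTc : Continuous T := hMcont.div_const _
    exact continuous_toAdd.sub (hnc.comp (hTc.comp continuous_toAdd))
  · exact hlog _
  · change (QuotientGroup.mk (s (.ofAdd (D.normCoord t - D.normCoord (T (D.normCoord t))))) :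
      𝔪.IdeleClassGroup) = 1
    have : T (D.normCoord t) = t := by
      simp only [T, hMn]
      field_simp
    rw [this, sub_self, ofAdd_zero, map_one]
    rfl
  · have hx : (QuotientGroup.mk (s (.ofAdd y)) : 𝔪.IdeleClassGroup) = x :=
      D.log_injective ((hlog y).trans hxy.symm)
    have h1 : ideleNorm (s (.ofAdd y)) = 1 := by
      have := x.2
      rw [← hx] at this
      exact this
    have h2 : T y = 0 := by
      have : M y = 0 := by
        change Real.log (ideleNorm (s (.ofAdd y))) = 0
        rw [h1, Real.log_one]
      simp only [T, this, zero_div]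
    have h3 : D.normCoord 0 = 0 := by
      ext <;> simp [normCoord]
    change (QuotientGroup.mk (s (.ofAdd (y - D.normCoord (T y)))) : 𝔪.IdeleClassGroup) = _
    rw [h2, h3, sub_zero, hx]

open scoped Classical in
theorem norm_le_of_norm_toSpace_le {y : D.Coord} {R : ℝ} (h : ‖D.toSpace y‖ ≤ R) : ‖y‖ ≤ R := by
  have hR : 0 ≤ R := (norm_nonneg _).trans h
  have hi : ∀ i, ‖D.toSpace y i‖ ≤ R := fun i ↦ (PiLp.norm_apply_le _ i).trans h
  simp only [norm_prod_le_iff, pi_norm_le_iff_of_nonneg hR]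
  refine ⟨fun p ↦ ?_, fun i ↦ ?_, fun σ ↦ ?_, fun σ ↦ ?_⟩
  · simpa [toSpace, Int.norm_eq_abs] using hi (.inl p)
  · simpa [toSpace, Int.norm_eq_abs] using hi (.inr (.inl i))
  · simpa [toSpace] using hi (.inr (.inr (.inl σ)))
  · simpa [toSpace] using hi (.inr (.inr (.inr σ)))

theorem exists_bound_mod_projLattice : ∃ R : ℝ, ∀ v : D.Hyperplane,
    ∃ l ∈ D.projLattice, ‖v - l‖ ≤ R := by
  have := D.discreteTopology_projLattice
  have : IsZLattice ℝ D.projLattice := ⟨D.span_projLattice⟩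
  have := ZLattice.module_free ℝ D.projLattice
  have := ZLattice.module_finite ℝ D.projLattice
  let b := (finBasis ℤ D.projLattice).ofZLatticeBasis ℝ D.projLattice
  refine ⟨∑ i, ‖b i‖, fun v ↦ ⟨ZSpan.floor b v, ?_, ZSpan.norm_fract_le b v⟩⟩
  exact (Basis.ofZLatticeBasis_span ℝ D.projLattice (finBasis ℤ D.projLattice)).le
    (ZSpan.floor b v).2

/-- The group `C_𝔪¹` is the image of a bounded subset of `ℤ^ℓ × ℝ^n`, as `p₀(Λ)` is cocompact. -/
theorem compactSpace_normOne (D : LogData F 𝔪) : CompactSpace 𝔪.normOne := by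
  classical
  obtain ⟨S, hS, -, hS1, hSlog⟩ := D.exists_section_normOne
  obtain ⟨R, hR⟩ := D.exists_bound_mod_projLattice
  refine ⟨((isCompact_closedBall (0 : D.Coord) R).image
    (hS.comp continuous_ofAdd)).of_isClosed_subset isClosed_univ fun x _ ↦ ?_⟩
  obtain ⟨y, hy⟩ := D.exists_log_eq x
  obtain ⟨_, ⟨l, hl, rfl⟩, hle⟩ := hR (D.p₀ (D.toSpace y))
  change ‖_ - D.p₀ (D.toSpace l)‖ ≤ R at hle
  rw [← map_sub, ← map_sub] at hle
  obtain ⟨t, ht⟩ := D.exists_eq_p₀_add_smul (D.toSpace (y - l))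
  have hx : S (.ofAdd (y - l)) = x := hSlog x _ <| by
    rw [hy, QuotientAddGroup.mk_sub, (QuotientAddGroup.eq_zero_iff l).2 hl, sub_zero]
  refine ⟨y - l - D.normCoord t, ?_, ?_⟩
  · rw [mem_closedBall_zero_iff]
    refine D.norm_le_of_norm_toSpace_le ?_
    rw [map_sub, toSpace_normCoord, ht, add_sub_cancel_right]
    exact hle
  · change S (.ofAdd (y - l - D.normCoord t)) = x
    rw [ofAdd_sub, map_div, hS1, div_one, hx]

/-! ### The dual group -/

theorem exists_inner_eq_int_of_mem_integral {w : D.Hyperplane} (hw : w ∈ D.integral)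
    (y : D.Coord) : ∃ k : ℤ, inner ℝ w (D.p₀ (D.toSpace y)) = k := by
  classical
  obtain ⟨z, ⟨-, -, hz⟩, hzw⟩ := hw
  have hz1 : z.2.2.1 = 0 := congrArg Prod.fst hz
  have hz2 : z.2.2.2 = 0 := congrArg Prod.snd hz
  have hzw' : D.toSpace z = (w : D.Space) := hzw
  refine ⟨(∑ p, z.1 p * y.1 p) + ∑ i, z.2.1 i * y.2.1 i, ?_⟩
  rw [inner_p₀, ← hzw', inner_toSpace]
  simp [toSpace, hz1, hz2]

theorem integral_le_dualLattice : D.integral ≤ D.dualLattice := by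
  rintro w hw _ ⟨y, -, rfl⟩
  obtain ⟨k, hk⟩ := D.exists_inner_eq_int_of_mem_integral hw y
  exact Submodule.mem_one.2 ⟨k, hk.symm⟩

/-- A vector whose pairings with `ℤ^ℓ × ℝ^n` are integers has integral entries at the integral
coordinates and vanishes at the real ones. -/
theorem mem_integral_of_forall_inner {w : D.Hyperplane}
    (hw : ∀ y : D.Coord, ∃ k : ℤ, inner ℝ (w : D.Space) (D.toSpace y) = k) : w ∈ D.integral := by
  classical
  have h1 : ∀ p, ∃ k : ℤ, (w : D.Space) (.inl p) = k := fun p ↦ by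
    obtain ⟨k, hk⟩ := hw (Pi.single p 1, 0, 0, 0)
    exact ⟨k, by rw [← hk, inner_toSpace]; simp [Pi.single_apply]⟩
  have h2 : ∀ i, ∃ k : ℤ, (w : D.Space) (.inr (.inl i)) = k := fun i ↦ by
    obtain ⟨k, hk⟩ := hw (0, Pi.single i 1, 0, 0)
    exact ⟨k, by rw [← hk, inner_toSpace]; simp [Pi.single_apply]⟩
  have h3 : ∀ σ, (w : D.Space) (.inr (.inr (.inl σ))) = 0 := fun σ ↦
    eq_zero_of_forall_mul_int fun t ↦ by
      obtain ⟨k, hk⟩ := hw (0, 0, Pi.single σ t, 0)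
      exact ⟨k, by rw [← hk, inner_toSpace]; simp [Pi.single_apply, mul_comm]⟩
  have h4 : ∀ σ, (w : D.Space) (.inr (.inr (.inr σ))) = 0 := fun σ ↦
    eq_zero_of_forall_mul_int fun t ↦ by
      obtain ⟨k, hk⟩ := hw (0, 0, 0, Pi.single σ t)
      exact ⟨k, by rw [← hk, inner_toSpace]; simp [Pi.single_apply, mul_comm]⟩
  choose a ha using h1
  choose b hb using h2
  refine ⟨(a, b, 0, 0), ⟨trivial, trivial, rfl⟩, PiLp.ext fun i ↦ ?_⟩
  rcases i with i | i | i | i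
  · exact (ha i).symm
  · exact (hb i).symm
  · exact (h3 i).symm
  · exact (h4 i).symm

/-- The homomorphism `p₀(Λ)^∨ → Hom(C_𝔪¹, 𝕌)` that sends `w` to the character
`x ↦ exp(2πi w·p₀(ℒ(x)))`. -/
def dualHom : D.dualLattice →+ Additive (PontryaginDual 𝔪.normOne) :=
  AddMonoidHom.mk' (fun w ↦ Additive.ofMul (show 𝔪.normOne →ₜ* Circle from
    { toMonoidHom := (D.latticeCharacter w).comp (D.log.comp 𝔪.normOne.subtype)
      continuous_toFun := (D.continuous_latticeCharacter_log w).comp continuous_subtype_val }))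
    fun v w ↦ by
      refine congrArg Additive.ofMul (PontryaginDual.ext fun x ↦ ?_)
      obtain ⟨y, hy⟩ := D.exists_log_eq x
      change D.latticeCharacter (v + w) (D.log x) =
        D.latticeCharacter v (D.log x) * D.latticeCharacter w (D.log x)
      rw [hy, latticeCharacter_apply, latticeCharacter_apply, latticeCharacter_apply,
        ← Circle.exp_add, ← mul_add, Submodule.coe_add, inner_add_left]

theorem dualHom_apply (w : D.dualLattice) (x : 𝔪.normOne) {y : D.Coord}
    (hy : D.log x = .ofAdd ↑y) : (D.dualHom w).toMul x =
      Circle.exp (2 * Real.pi * inner ℝ (w : D.Hyperplane) (D.p₀ (D.toSpace y))) := by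
  change D.latticeCharacter w (D.log x) = _
  rw [hy, latticeCharacter_apply]

theorem dualHom_eq_zero_iff (w : D.dualLattice) :
    D.dualHom w = 0 ↔ (w : D.Hyperplane) ∈ D.integral := by
  constructor
  · intro h
    obtain ⟨S, -, hS, -, -⟩ := D.exists_section_normOne
    refine D.mem_integral_of_forall_inner fun y ↦ ?_
    obtain ⟨t, ht⟩ := hS y
    have h1 := D.dualHom_apply w _ ht
    rw [h, p₀_toSpace_sub_normCoord, inner_p₀] at h1
    exact exp_two_pi_mul_eq_one_iff.1 h1.symm
  · intro h
    refine congrArg Additive.ofMul (a₂ := 1) (PontryaginDual.ext fun x ↦ ?_)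
    obtain ⟨y, hy⟩ := D.exists_log_eq x
    refine (D.dualHom_apply w x hy).trans ?_
    exact exp_two_pi_mul_eq_one_iff.2 (D.exists_inner_eq_int_of_mem_integral h y)

theorem dualHom_surjective : Function.Surjective D.dualHom := by
  intro χ
  obtain ⟨S, hS, -, hS1, hSlog⟩ := D.exists_section_normOne
  obtain ⟨w, hw⟩ := D.exists_inner_eq (fun y ↦ χ.toMul (S (.ofAdd y)))
    ((map_continuous χ.toMul).comp (hS.comp continuous_ofAdd))
    fun x y ↦ by rw [ofAdd_add, map_mul, map_mul]
  have hperp : w ∈ D.Hyperplane := by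
    rw [Submodule.mem_orthogonal_singleton_iff_inner_left]
    refine eq_zero_of_forall_mul_int fun t ↦ ?_
    have h := hw (D.normCoord t)
    rw [hS1, map_one, toSpace_normCoord, inner_smul_right] at h
    exact exp_two_pi_mul_eq_one_iff.1 h.symm
  have hdual : (⟨w, hperp⟩ : D.Hyperplane) ∈ D.dualLattice := by
    rintro _ ⟨y, hy, rfl⟩
    have h := hw y
    have h1 : S (.ofAdd y) = 1 := hSlog 1 y <| by
      rw [(QuotientAddGroup.eq_zero_iff y).2 hy]
      exact map_one D.log
    rw [h1, map_one] at h
    obtain ⟨k, hk⟩ := exp_two_pi_mul_eq_one_iff.1 h.symm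
    refine Submodule.mem_one.2 ⟨k, ?_⟩
    exact (hk.symm.trans (D.inner_p₀ ⟨w, hperp⟩ (D.toSpace y)).symm)
  refine ⟨⟨_, hdual⟩, congrArg Additive.ofMul (a₁ := (D.dualHom ⟨_, hdual⟩).toMul)
    (a₂ := χ.toMul)
    (PontryaginDual.ext fun x ↦ ?_)⟩
  obtain ⟨y, hy⟩ := D.exists_log_eq x
  rw [D.dualHom_apply _ x hy, inner_p₀, ← hw, hSlog x y hy]

end LogData

end Hecke

end

theorem mainTheorem2 {F : Type*} [Field F] [NumberField F] (𝔪 : Hecke.Modulus F)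
    (D : Hecke.LogData F 𝔪) :
    (DiscreteTopology D.projLattice ∧ Submodule.span ℝ (D.projLattice : Set D.Hyperplane) = ⊤) ∧
    D.integral ≤ D.dualLattice ∧
    (∃ e : PontryaginDual 𝔪.normOne ≃ₜ*
        Multiplicative (D.dualLattice ⧸ D.integral.submoduleOf D.dualLattice),
      ∀ (w : D.dualLattice) (x : 𝔪.normOne) (y : D.Coord),
        D.log x = Multiplicative.ofAdd (y : D.Coord ⧸ D.lattice) →
          e.symm (Multiplicative.ofAdd (Submodule.Quotient.mk w)) x =
            Circle.exp (2 * Real.pi * inner ℝ (w : D.Hyperplane) (D.p₀ (D.toSpace y)))) ∧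
    DiscreteTopology (PontryaginDual 𝔪.normOne) ∧ Group.FG (PontryaginDual 𝔪.normOne) := by
  -- `C_𝔪¹` is compact, so its dual is discrete, as is the quotient of the dual lattice: every group
  -- isomorphism between them is a homeomorphism.
  have hcompact := D.compactSpace_normOne
  have hdiscrete : DiscreteTopology D.dualLattice := by
    obtain ⟨n, b, h⟩ := D.exists_basis_dualLattice
    rw [h]
    infer_instance
  have hfinite : Module.Finite ℤ D.dualLattice := by
    obtain ⟨n, b, h⟩ := D.exists_basis_dualLattice
    rw [h]
    infer_instance
  have hker : D.integral.submoduleOf D.dualLattice = LinearMap.ker D.dualHom.toIntLinearMap := by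
    ext w
    exact (D.dualHom_eq_zero_iff w).symm
  let E : (D.dualLattice ⧸ D.integral.submoduleOf D.dualLattice) ≃+
      Additive (PontryaginDual 𝔪.normOne) :=
    ((Submodule.quotEquivOfEq _ _ hker).trans
      (D.dualHom.toIntLinearMap.quotKerEquivOfSurjective D.dualHom_surjective)).toAddEquiv
  have hquot : DiscreteTopology (D.dualLattice ⧸ D.integral.submoduleOf D.dualLattice) :=
    discreteTopology_iff_forall_isOpen.2 fun s ↦
      isOpen_coinduced.2 (isOpen_discrete _)
  refine ⟨⟨D.discreteTopology_projLattice, D.span_projLattice⟩, D.integral_le_dualLattice,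
    ⟨⟨(AddEquiv.toMultiplicativeLeft E).symm, continuous_of_discreteTopology,
      continuous_of_discreteTopology⟩, fun w x y hy ↦ D.dualHom_apply w x hy⟩, inferInstance, ?_⟩
  have hfg : Group.FG (Multiplicative D.dualLattice) :=
    AddGroup.fg_iff_mul_fg.1 (Module.Finite.iff_addGroup_fg.1 hfinite)
  exact Group.fg_of_surjective (f := AddMonoidHom.toMultiplicativeLeft D.dualHom)
    D.dualHom_surjective
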